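/- Let $f$ be a polynomial over $\mathbb{F}_2$ of degree at most 3 in $n$ variables with no constant term (a sum of products of at most three distinct variables), and let $\mathrm{gap}(f)=\sum_{x\in\{0,1\}^n}(-1)^{f(x)}$. Consider quantum circuits on $\ell$ qubits that start and end with a column of Hadamard gates and whose internal part is a sequence of Hadamard, Z, CZ and CCZ gates with at least one gate acting on each qubit. The internal Hadamard gates divide the wires of the internal part into segments. Associate a distinct variable with each segment, and let the polynomial of the circuit be the sum over $\mathbb{F}_2$ of the following terms, one for each internal gate: for a Hadamard gate, the product of the variables of the two segments that it joins; for a Z, CZ or CCZ gate, the product of the variables of the one, two or three segments on which it acts. The circuit corresponds to $f$ if its polynomial, for some labelling of the segments by the $n$ variables, is $f$. The quantum circuit width $w(f)$ is the minimal number $\ell$ of qubits of a circuit that corresponds to $f$. Then the following problem is BQP-hard: given $f$ (as a list of monomials), output a rational number $a$ with $$|a-\mathrm{gap}(f)|\le \tfrac13\cdot 2^{(n+w(f))/2}.$$ That is, for every language $L$ in BQP there are two functions computable by deterministic Turing machines in polynomial time, the first mapping each binary string $x$ to such a polynomial $f_x$, the second mapping a pair $(x,a)$ to a bit, such that for every $x$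 and every rational $a$ with $|a-\mathrm{gap}(f_x)|\le \frac13\cdot 2^{(n+w(f_x))/2}$, where $n$ is the number of variables of $f_x$, the bit for $(x,a)$ is 1 if and only if $x\in L$. Here BQP is the class of languages $L\subseteq\{0,1\}^*$ for which a polynomial-time Turing machine maps each $x$ to a quantum circuit $U_x$ of Hadamard, phase ($|1\rangle\mapsto i|1\rangle$) and Toffoli gates such that measuring the first qubit of $U_x|0\cdots0\rangle$ gives 1 with probability at least $2/3$ if $x\in L$ and at most $1/3$ if $x\notin L$. -/

import Mathlib

namespace CubicGap

/-! ## Circuits over Hadamard, Z, CZ, CCZ and their polynomials -/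

/-- A gate from the set `{H, Z, CZ, CCZ}` on `l` qubits; multi-qubit gates act on distinct qubits. -/
inductive Gate (l : ℕ) : Type
  | H (i : Fin l)
  | Z (i : Fin l)
  | CZ (i j : Fin l) (hij : i ≠ j)
  | CCZ (i j k : Fin l) (hij : i ≠ j) (hik : i ≠ k) (hjk : j ≠ k)

namespace Gate

variable {l : ℕ}

/-- The gate acts on qubit `q`. -/
def ActsOn : Gate l → Fin l → Prop
  | H i, q => q = i
  | Z i, q => q = i
  | CZ i j _, q => q = i ∨ q = j
  | CCZ i j k _ _ _, q => q = i ∨ q = j ∨ q = k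

/-- The gate is a Hadamard gate on qubit `q`. -/
def IsHadamardOn : Gate l → Fin l → Bool
  | H i, q => decide (i = q)
  | Z _, _ => false
  | CZ _ _ _, _ => false
  | CCZ _ _ _ _ _ _, _ => false

end Gate

/-- The internal part of a quantum circuit on `l` qubits over `{H, Z, CZ, CCZ}`: the list of gates,
in order of application, between the initial and the final column of Hadamard gates. -/
abbrev InternalCircuit (l : ℕ) : Type := List (Gate l)

namespace InternalCircuit

variable {l : ℕ}

/-- The number of (internal) Hadamard gates on wire `q`. -/
def hadamards (C : InternalCircuit l) (q : Fin l) : ℕ := C.countP fun g => g.IsHadamardOn q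

/-- The segments into which the Hadamard gates divide the wires. The pair `(q, t)` is the segment
of wire `q` that is preceded by exactly `t` Hadamard gates on that wire. -/
def segments (C : InternalCircuit l) : Set (Fin l × ℕ) := {s | s.2 ≤ C.hadamards s.1}

open MvPolynomial in
/-- The sum of the terms of the gates of a circuit, where `(q, cur q)` is the segment of wire `q`
on which the circuit starts. A Hadamard gate contributes the product of the two segments that it
joins; a Z, CZ or CCZ gate contributes the product of the segments on which it acts. -/
noncomputable def segmentPolyFrom :
    (Fin l → ℕ) → InternalCircuit l → MvPolynomial (Fin l × ℕ) (ZMod 2)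
  | _, [] => 0
  | cur, Gate.H i :: C =>
      X (i, cur i) * X (i, cur i + 1) + segmentPolyFrom (Function.update cur i (cur i + 1)) C
  | cur, Gate.Z i :: C => X (i, cur i) + segmentPolyFrom cur C
  | cur, Gate.CZ i j _ :: C => X (i, cur i) * X (j, cur j) + segmentPolyFrom cur C
  | cur, Gate.CCZ i j k _ _ _ :: C =>
      X (i, cur i) * X (j, cur j) * X (k, cur k) + segmentPolyFrom cur C

/-- The polynomial of a circuit, with the segments of the wires as its variables. -/
noncomputable def segmentPoly (C : InternalCircuit l) : MvPolynomial (Fin l × ℕ) (ZMod 2) :=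
  segmentPolyFrom (fun _ => 0) C

/-- The circuit corresponds to the polynomial `f` in `n` variables: at least one internal gate acts
on each qubit, and for some labelling `e` of the segments by the `n` variables (one distinct
variable for each segment) the polynomial of the circuit is `f`. -/
def Corresponds (C : InternalCircuit l) {n : ℕ} (f : MvPolynomial (Fin n) (ZMod 2)) : Prop :=
  (∀ q : Fin l, ∃ g ∈ C, g.ActsOn q) ∧
    ∃ e : Fin n → Fin l × ℕ, Function.Injective e ∧ Set.range e = C.segments ∧
      MvPolynomial.rename e f = C.segmentPoly

end InternalCircuit

/-- The quantum circuit width: the minimal number of qubits of a circuit corresponding to `f`. -/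
noncomputable def circuitWidth {n : ℕ} (f : MvPolynomial (Fin n) (ZMod 2)) : ℕ :=
  sInf {l : ℕ | ∃ C : InternalCircuit l, C.Corresponds f}

/-- The number of zeroes minus the number of ones of `f` on `{0,1}^n`. -/
noncomputable def gap {n : ℕ} (f : MvPolynomial (Fin n) (ZMod 2)) : ℤ :=
  ∑ x : Fin n → ZMod 2, if MvPolynomial.eval x f = 0 then 1 else -1

/-! ## Degree-3 polynomials as inputs of an algorithm -/

/-- A polynomial of degree at most 3 over `ZMod 2` in `n` variables, without constant term, written
as a list of monomials, each of which is a product of one, two or three distinct variables. -/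
structure CubicPoly where
  /-- the number of variables -/
  n : ℕ
  /-- the monomials -/
  terms : List (List (Fin n))
  terms_ok : ∀ t ∈ terms, t ≠ [] ∧ t.length ≤ 3 ∧ t.Nodup

/-- The polynomial that is written down. -/
noncomputable def CubicPoly.poly (P : CubicPoly) : MvPolynomial (Fin P.n) (ZMod 2) :=
  (P.terms.map fun t => (t.map MvPolynomial.X).prod).sum

/-- Alphabet for polynomials. -/
inductive PolySym : Type
  | tick
  | comma
  | semicolon

/-- A number in unary, followed by a comma. -/
def PolySym.num (m : ℕ) : List PolySym := List.replicate m PolySym.tick ++ [PolySym.comma]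

/-- The string that describes a polynomial: the number of variables, and then, for each monomial,
its variables and a semicolon. -/
def CubicPoly.encode (P : CubicPoly) : List PolySym :=
  PolySym.num P.n ++
    P.terms.flatMap fun t => (t.flatMap fun i => PolySym.num i) ++ [PolySym.semicolon]

/-! ## Polynomial time and BQP -/

/-- `f` is computable by a deterministic Turing machine in time polynomial in the length of the
encoded input. -/
def PolyTime {α β A B : Type} (ea : α → List A) (eb : β → List B) (f : α → β) : Prop :=
  Nonempty (Turing.TM2ComputableInPolyTime ea eb f)

/-- A Hadamard, phase (`|1⟩ ↦ i|1⟩`) or Toffoli gate on `l` qubits. In `toffoli a b c` the qubits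
`a`, `b` are the controls and `c` is the target. -/
inductive QGate (l : ℕ) : Type
  | hadamard (a : Fin l)
  | phase (a : Fin l)
  | toffoli (a b c : Fin l) (hab : a ≠ b) (hac : a ≠ c) (hbc : b ≠ c)

/-- The amplitudes, in the computational basis, of a (pure) state of `l` qubits. -/
abbrev QState (l : ℕ) : Type := (Fin l → Bool) → ℂ

/-- The action of a gate on states. -/
noncomputable def QGate.apply {l : ℕ} : QGate l → QState l → QState l
  | QGate.hadamard a, ψ => fun x =>
      (1 / (Real.sqrt 2 : ℂ)) * (ψ (Function.update x a false) +
        (if x a then -1 else 1) * ψ (Function.update x a true))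
  | QGate.phase a, ψ => fun x => (if x a then Complex.I else 1) * ψ x
  | QGate.toffoli a b c _ _ _, ψ => fun x => ψ (Function.update x c (xor (x c) (x a && x b)))

/-- A quantum circuit on at least one qubit; the gates are listed in order of application. -/
structure QCircuit where
  /-- the number of qubits -/
  qubits : ℕ
  qubits_pos : 0 < qubits
  /-- the gates -/
  gates : List (QGate qubits)

/-- The state that the circuit produces from `|0…0⟩`. -/
noncomputable def QCircuit.output (C : QCircuit) : QState C.qubits :=
  C.gates.foldl (fun ψ g => g.apply ψ) (Pi.single (fun _ => false) 1)

/-- The probability that measuring the first qubit of the output state gives 1. -/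
noncomputable def QCircuit.acceptProb (C : QCircuit) : ℝ :=
  ∑ x : Fin C.qubits → Bool, if x ⟨0, C.qubits_pos⟩ then ‖C.output x‖ ^ 2 else 0

/-- Alphabet for quantum circuits. -/
inductive CircSym : Type
  | tick
  | comma
  | hadamard
  | phase
  | toffoli

/-- A number in unary, followed by a comma. -/
def CircSym.num (m : ℕ) : List CircSym := List.replicate m CircSym.tick ++ [CircSym.comma]

/-- The string that describes a gate: its kind and the qubits on which it acts. -/
def QGate.encode {l : ℕ} : QGate l → List CircSym
  | QGate.hadamard a => CircSym.hadamard :: CircSym.num a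
  | QGate.phase a => CircSym.phase :: CircSym.num a
  | QGate.toffoli a b c _ _ _ =>
      CircSym.toffoli :: (CircSym.num a ++ CircSym.num b ++ CircSym.num c)

/-- The string that describes a circuit: the number of qubits and then the gates. -/
def QCircuit.encode (C : QCircuit) : List CircSym :=
  CircSym.num C.qubits ++ C.gates.flatMap QGate.encode

/-- The class of decision problems that are solved with success probability at least 2/3 by
applying to `|0…0⟩` a quantum circuit generated from the input in polynomial time, and measuring the
first qubit. -/
def BQP : Set (Language Bool) :=
  {L | ∃ C : List Bool → QCircuit, PolyTime id QCircuit.encode C ∧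
    ∀ x : List Bool, (x ∈ L → 2 / 3 ≤ (C x).acceptProb) ∧ (x ∉ L → (C x).acceptProb ≤ 1 / 3)}

/-! ## Hardness of approximation problems -/

/-- The string that describes a binary string together with a rational number: the string, a
separator, the sign bit and the binary digits of the numerator, a separator, and the binary digits
of the denominator. -/
def encodeAnswer (p : List Bool × ℚ) : List (Option Bool) :=
  p.1.map some ++ none ::
    some (decide (p.2 < 0)) :: (Computability.encodeNat p.2.num.natAbs).map some ++
      none :: (Computability.encodeNat p.2.den).map some

/-- The problem "given (the description of) an instance `i`, output a rational number within `err i`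
of `val i`" is BQP-hard: each language in BQP reduces to it in polynomial time. The reduction
computes from the input `x` one instance, `query x`, and decides, from `x` and whatever valid answer
`a` it is given for this instance, whether `x` is in the language. -/
def EstimationBQPHard {ι S : Type} (enc : ι → List S) (val err : ι → ℝ) : Prop :=
  ∀ L ∈ BQP, ∃ (query : List Bool → ι) (answer : List Bool × ℚ → Bool),
    PolyTime id enc query ∧ PolyTime encodeAnswer Computability.encodeBool answer ∧
      ∀ (x : List Bool) (a : ℚ), |(a : ℝ) - val (query x)| ≤ err (query x) →
        (answer (x, a) = true ↔ x ∈ L)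

end CubicGap

/-
A quantum circuit `U` over Hadamard, phase and Toffoli gates is realized, up to a power of `√2`, by
Hadamard, Z, CZ and CCZ gates on real states with one more qubit, which tells the real part of a
state from its imaginary part. The circuit `U† Z U`, with Z on the measured qubit, has amplitude
`1 - 2 * p` at `|0…0⟩`, where `p` is the acceptance probability, and the gap of its polynomial is
`2 ^ k * (1 - 2 * p)`, where `2 * k` is the number of variables plus the number of qubits. Hence an
estimate within `2 ^ k / 3` of the gap is nonnegative if `p ≤ 1/3`. It is negative if `2/3 ≤ p`: the
gap is then at most `-2 ^ k / 3`, and not equal to it, being an integer. So the sign of the estimate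
decides the language.

The polynomial is computed by the composition of two machines: one writes the gates of `U† Z U`, the
other reads them and keeps the current variable of each wire on a stack.
-/

namespace CubicGap

open Function

/-! ### Composition of polynomial-time functions -/

open Turing

section MachineEmbedding

variable {K K' : Type} {Γ : K → Type} {Γ' : K' → Type} {Λ Λ' σ σ' : Type}

/-- An embedding of the stacks, symbols, labels and internal states of a stack machine into those of
a larger one. -/
structure MachineEmbedding (Γ : K → Type) (Λ σ : Type) (Γ' : K' → Type) (Λ' σ' : Type) where
  stack : K → K'
  stack_injective : Injective stack
  symbol : ∀ k, Γ k ≃ Γ' (stack k)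
  label : Λ → Λ'
  incl : σ → σ'
  proj : σ' → σ
  proj_incl : ∀ v, proj (incl v) = v

namespace MachineEmbedding

/-- Transport of a statement along an embedding; `fin` replaces `halt`. -/
def stmt (E : MachineEmbedding Γ Λ σ Γ' Λ' σ') (fin : TM2.Stmt Γ' Λ' σ') :
    TM2.Stmt Γ Λ σ → TM2.Stmt Γ' Λ' σ'
  | .push k f q => .push (E.stack k) (fun v => E.symbol k (f (E.proj v))) (E.stmt fin q)
  | .peek k f q => .peek (E.stack k)
      (fun v o => E.incl (f (E.proj v) (o.map (E.symbol k).symm))) (E.stmt fin q)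
  | .pop k f q => .pop (E.stack k)
      (fun v o => E.incl (f (E.proj v) (o.map (E.symbol k).symm))) (E.stmt fin q)
  | .load f q => .load (fun v => E.incl (f (E.proj v))) (E.stmt fin q)
  | .branch f q₁ q₂ => .branch (fun v => f (E.proj v)) (E.stmt fin q₁) (E.stmt fin q₂)
  | .goto f => .goto fun v => E.label (f (E.proj v))
  | .halt => fin

/-- The stacks `S` of the small machine appear as the stacks `S'` of the large machine, whose other
stacks are empty. -/
def StkRel (E : MachineEmbedding Γ Λ σ Γ' Λ' σ') (S : ∀ k, List (Γ k)) (S' : ∀ k, List (Γ' k)) :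
    Prop :=
  (∀ k, S' (E.stack k) = (S k).map (E.symbol k)) ∧ ∀ j, (∀ k, E.stack k ≠ j) → S' j = []

/-- A configuration of the small machine and its image in the large machine, in which the halting
label is replaced by `fl`. -/
def CfgRel (E : MachineEmbedding Γ Λ σ Γ' Λ' σ') (fl : Option Λ') (c : TM2.Cfg Γ Λ σ)
    (c' : TM2.Cfg Γ' Λ' σ') : Prop :=
  c'.l = c.l.elim fl (some ∘ E.label) ∧ c'.var = E.incl c.var ∧ E.StkRel c.stk c'.stk

variable {E : MachineEmbedding Γ Λ σ Γ' Λ' σ'}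

theorem StkRel.unique {S : ∀ k, List (Γ k)} {S' S'' : ∀ k, List (Γ' k)} (h' : E.StkRel S S')
    (h'' : E.StkRel S S'') : S' = S'' := by
  funext j
  by_cases hj : ∃ k, E.stack k = j
  · obtain ⟨k, rfl⟩ := hj
    rw [h'.1, h''.1]
  · rw [h'.2 j fun k hk => hj ⟨k, hk⟩, h''.2 j fun k hk => hj ⟨k, hk⟩]

theorem StkRel.head?_map_symm {S : ∀ k, List (Γ k)} {S' : ∀ k, List (Γ' k)} (h : E.StkRel S S')
    (k : K) : (S' (E.stack k)).head?.map (E.symbol k).symm = (S k).head? := by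
  rw [h.1 k]
  cases S k <;> simp

variable [DecidableEq K] [DecidableEq K']

theorem StkRel.update {S : ∀ k, List (Γ k)} {S' : ∀ k, List (Γ' k)} (h : E.StkRel S S') (k : K)
    (s : List (Γ k)) :
    E.StkRel (update S k s) (update S' (E.stack k) (s.map (E.symbol k))) := by
  refine ⟨fun k' => ?_, fun j hj => ?_⟩
  · obtain rfl | hk := eq_or_ne k' k
    · rw [update_self, update_self]
    · rw [update_of_ne hk, update_of_ne (E.stack_injective.ne hk), h.1]
  · rw [update_of_ne (hj k).symm, h.2 j hj]

theorem stkRel_single (E : MachineEmbedding Γ Λ σ Γ' Λ' σ') (k : K) (s : List (Γ k)) :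
    E.StkRel (Function.update (fun _ => []) k s)
      (Function.update (fun _ => []) (E.stack k) (s.map (E.symbol k))) :=
  StkRel.update ⟨fun _ => rfl, fun _ _ => rfl⟩ k s

variable {fin : TM2.Stmt Γ' Λ' σ'} {fl : Option Λ'}

theorem cfgRel_stepAux (hfin : ∀ v S, TM2.stepAux fin (E.incl v) S = ⟨fl, E.incl v, S⟩)
    (q : TM2.Stmt Γ Λ σ) (v : σ) (S : ∀ k, List (Γ k)) (S' : ∀ k, List (Γ' k))
    (h : E.StkRel S S') :
    E.CfgRel fl (TM2.stepAux q v S) (TM2.stepAux (E.stmt fin q) (E.incl v) S') := by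
  induction q generalizing v S S' with
  | push k f q ih =>
    simp only [stmt, TM2.stepAux, E.proj_incl]
    have hk := h.update k (f v :: S k)
    rw [List.map_cons, ← h.1 k] at hk
    exact ih _ _ _ hk
  | peek k f q ih =>
    simp only [stmt, TM2.stepAux, E.proj_incl, h.head?_map_symm]
    exact ih _ _ _ h
  | pop k f q ih =>
    simp only [stmt, TM2.stepAux, E.proj_incl, h.head?_map_symm]
    have hk := h.update k (S k).tail
    rw [List.map_tail, ← h.1 k] at hk
    exact ih _ _ _ hk
  | load f q ih =>
    simp only [stmt, TM2.stepAux, E.proj_incl]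
    exact ih _ _ _ h
  | branch f q₁ q₂ ih₁ ih₂ =>
    simp only [stmt, TM2.stepAux, E.proj_incl]
    cases f v
    · exact ih₂ _ _ _ h
    · exact ih₁ _ _ _ h
  | goto f =>
    simp only [stmt, TM2.stepAux, E.proj_incl]
    exact ⟨rfl, rfl, h⟩
  | halt =>
    simp only [stmt, TM2.stepAux, hfin]
    exact ⟨rfl, rfl, h⟩

end MachineEmbedding

theorem iterate_bind_none {α : Type*} (f : α → Option α) (t : ℕ) :
    (flip bind f)^[t] none = none :=
  iterate_fixed rfl t

variable [DecidableEq K] [DecidableEq K'] {E : MachineEmbedding Γ Λ σ Γ' Λ' σ'}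
  {fin : TM2.Stmt Γ' Λ' σ'} {fl : Option Λ'}

theorem MachineEmbedding.exists_cfgRel_iterate
    (hfin : ∀ v S, TM2.stepAux fin (E.incl v) S = ⟨fl, E.incl v, S⟩)
    {M : Λ → TM2.Stmt Γ Λ σ} {M' : Λ' → TM2.Stmt Γ' Λ' σ'}
    (hM : ∀ l, M' (E.label l) = E.stmt fin (M l)) {t : ℕ} {c d : TM2.Cfg Γ Λ σ}
    {c' : TM2.Cfg Γ' Λ' σ'} (h : E.CfgRel fl c c')
    (hd : (flip bind (TM2.step M))^[t] (some c) = some d) :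
    ∃ d', E.CfgRel fl d d' ∧ (flip bind (TM2.step M'))^[t] (some c') = some d' := by
  induction t generalizing c c' with
  | zero =>
    obtain rfl : c = d := Option.some_injective _ hd
    exact ⟨c', h, rfl⟩
  | succ t ih =>
    rw [iterate_succ_apply] at hd
    obtain ⟨_ | l, v, S⟩ := c
    · exact absurd ((iterate_bind_none (TM2.step M) t).symm.trans hd) nofun
    · obtain ⟨l', v', S'⟩ := c'
      obtain ⟨rfl, rfl, hS⟩ := h
      have hstep := E.cfgRel_stepAux hfin (M l) v S S' hS
      rw [← hM] at hstep
      exact ih hstep hd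

end MachineEmbedding

section OutputLength

variable {K : Type} [DecidableEq K] {Γ : K → Type} {Λ σ : Type}

/-- A bound for the number of symbols that a statement pushes. -/
def pushBound : TM2.Stmt Γ Λ σ → ℕ
  | .push _ _ q => pushBound q + 1
  | .peek _ _ q => pushBound q
  | .pop _ _ q => pushBound q
  | .load _ q => pushBound q
  | .branch _ q₁ q₂ => pushBound q₁ + pushBound q₂
  | .goto _ => 0
  | .halt => 0

theorem length_stepAux_le (q : TM2.Stmt Γ Λ σ) (k : K) (v : σ) (S : ∀ k, List (Γ k)) :
    ((TM2.stepAux q v S).stk k).length ≤ (S k).length + pushBound q := by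
  induction q generalizing v S with
  | push k' f q ih =>
    refine (ih _ _).trans ?_
    obtain rfl | hk := eq_or_ne k k'
    · simp only [update_self, List.length_cons, pushBound]
      lia
    · simp [update_of_ne hk, pushBound]
  | pop k' f q ih =>
    refine (ih _ _).trans ?_
    obtain rfl | hk := eq_or_ne k k'
    · simp [pushBound]
    · simp [update_of_ne hk, pushBound]
  | peek _ _ _ ih => exact ih _ _
  | load _ _ ih => exact ih _ _
  | branch f q₁ q₂ ih₁ ih₂ =>
    simp only [TM2.stepAux, pushBound]
    cases f v
    · exact (ih₂ _ _).trans (by lia)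
    · exact (ih₁ _ _).trans (by lia)
  | goto f => exact le_rfl
  | halt => exact le_rfl

theorem length_iterate_step_le {M : Λ → TM2.Stmt Γ Λ σ} {b : ℕ} (hb : ∀ l, pushBound (M l) ≤ b)
    (k : K) {t : ℕ} {c d : TM2.Cfg Γ Λ σ}
    (hd : (flip bind (TM2.step M))^[t] (some c) = some d) :
    (d.stk k).length ≤ (c.stk k).length + t * b := by
  induction t generalizing c with
  | zero =>
    obtain rfl : c = d := Option.some_injective _ hd
    exact Nat.le_add_right _ _
  | succ t ih =>
    rw [iterate_succ_apply] at hd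
    obtain ⟨_ | l, v, S⟩ := c
    · exact absurd ((iterate_bind_none (TM2.step M) t).symm.trans hd) nofun
    · have hstep := length_stepAux_le (M l) k v S
      have hrest := ih hd
      have hl := hb l
      dsimp only [TM2.step] at hrest ⊢
      rw [add_mul]
      lia

theorem stk_initList (tm : FinTM2) (s : List (tm.Γ tm.k₀)) :
    (initList tm s).stk = update (fun _ => []) tm.k₀ s := by
  funext k
  obtain rfl | hk := eq_or_ne k tm.k₀ <;> simp [initList, *]

theorem stk_haltList (tm : FinTM2) (s : List (tm.Γ tm.k₁)) :
    (haltList tm s).stk = update (fun _ => []) tm.k₁ s := by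
  funext k
  obtain rfl | hk := eq_or_ne k tm.k₁ <;> simp [haltList, *]

theorem length_initList_stk_le (tm : FinTM2) (s : List (tm.Γ tm.k₀)) (k : tm.K) :
    ((initList tm s).stk k).length ≤ s.length := by
  rw [stk_initList]
  obtain rfl | hk := eq_or_ne k tm.k₀
  · rw [update_self]
  · simp [update_of_ne hk]

theorem exists_polynomial_length_le {α β A B : Type} {ea : α → List A} {eb : β → List B}
    {f : α → β} (h : TM2ComputableInPolyTime ea eb f) :
    ∃ p : Polynomial ℕ, ∀ a, (eb (f a)).length ≤ p.eval (ea a).length := by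
  let := h.tm.ΛFin
  let b := ∑ l, pushBound (h.tm.m l)
  have hb : ∀ l, pushBound (h.tm.m l) ≤ b := fun l =>
    Finset.single_le_sum (f := fun l => pushBound (h.tm.m l)) (fun _ _ => Nat.zero_le _)
      (Finset.mem_univ l)
  refine ⟨.X + h.time * .C b, fun a => ?_⟩
  obtain ⟨⟨t, ht⟩, hle⟩ := h.outputsFun a
  have hinput := length_initList_stk_le h.tm ((ea a).map h.inputAlphabet.invFun) h.tm.k₁
  have houtput := length_iterate_step_le hb h.tm.k₁ ht
  rw [stk_haltList, update_self, List.length_map] at houtput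
  rw [List.length_map] at hinput
  have hsteps : t * b ≤ h.time.eval (ea a).length * b := Nat.mul_le_mul_right _ hle
  simp only [Polynomial.eval_add, Polynomial.eval_X, Polynomial.eval_mul, Polynomial.eval_C]
  lia

theorem monotone_eval_nat (p : Polynomial ℕ) : Monotone fun a => p.eval a := by
  intro a b h
  simp only [Polynomial.eval_eq_sum]
  exact Finset.sum_le_sum fun i _ => Nat.mul_le_mul_left _ (Nat.pow_le_pow_left h i)

end OutputLength

section Composition

variable (M₁ M₂ : FinTM2) (e₀ : M₂.Γ M₂.k₀ ≃ M₁.Γ M₁.k₁)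

/-- The stacks of the second machine in the composition: its input stack is the output stack of the
first machine. -/
def compStk (k : M₂.K) : M₁.K ⊕ M₂.K := if k = M₂.k₀ then Sum.inl M₁.k₁ else Sum.inr k

theorem compStk_k₀ : compStk M₁ M₂ M₂.k₀ = Sum.inl M₁.k₁ := if_pos rfl

theorem compStk_injective : Injective (compStk M₁ M₂) := by
  intro a b h
  unfold compStk at h
  split_ifs at h with ha hb hb
  · rw [ha, hb]
  · exact Sum.inr_injective h

/-- The symbols of the second machine in the composition. -/
def compEquiv (k : M₂.K) : M₂.Γ k ≃ Sum.elim M₁.Γ M₂.Γ (compStk M₁ M₂ k) :=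
  if h : k = M₂.k₀ then
    ((Equiv.cast (by rw [h])).trans e₀).trans (Equiv.cast (by simp [compStk, h]))
  else Equiv.cast (by simp [compStk, h])

theorem compEquiv_heq (x : M₂.Γ M₂.k₀) : HEq (compEquiv M₁ M₂ e₀ M₂.k₀ x) (e₀ x) := by
  simp [compEquiv]

/-- The first machine as a part of the composition. -/
def compFst : MachineEmbedding M₁.Γ M₁.Λ M₁.σ (Sum.elim M₁.Γ M₂.Γ) (M₁.Λ ⊕ M₂.Λ) (M₁.σ × M₂.σ) where
  stack := Sum.inl
  stack_injective := Sum.inl_injective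
  symbol _ := Equiv.refl _
  label := Sum.inl
  incl v := (v, M₂.initialState)
  proj := Prod.fst
  proj_incl _ := rfl

/-- The second machine as a part of the composition. -/
def compSnd : MachineEmbedding M₂.Γ M₂.Λ M₂.σ (Sum.elim M₁.Γ M₂.Γ) (M₁.Λ ⊕ M₂.Λ) (M₁.σ × M₂.σ) where
  stack := compStk M₁ M₂
  stack_injective := compStk_injective M₁ M₂
  symbol := compEquiv M₁ M₂ e₀
  label := Sum.inr
  incl v := (M₁.initialState, v)
  proj := Prod.snd
  proj_incl _ := rfl

/-- The machine that runs `M₁` and then `M₂` on the output of `M₁`. -/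
def compTM : FinTM2 :=
  letI := M₁.kDecidableEq
  letI := M₂.kDecidableEq
  letI := M₁.kFin
  letI := M₂.kFin
  letI := M₁.ΛFin
  letI := M₂.ΛFin
  letI := M₁.σFin
  letI := M₂.σFin
  { K := M₁.K ⊕ M₂.K
    k₀ := Sum.inl M₁.k₀
    k₁ := compStk M₁ M₂ M₂.k₁
    Γ := Sum.elim M₁.Γ M₂.Γ
    Λ := M₁.Λ ⊕ M₂.Λ
    main := Sum.inl M₁.main
    σ := M₁.σ × M₂.σ
    initialState := (M₁.initialState, M₂.initialState)
    Γk₀Fin := M₁.Γk₀Fin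
    m := Sum.elim
      (fun l => (compFst M₁ M₂).stmt (.goto fun _ => Sum.inr M₂.main) (M₁.m l))
      (fun l => (compSnd M₁ M₂ e₀).stmt .halt (M₂.m l)) }

theorem cfgRel_compFst_initList (s : List (M₁.Γ M₁.k₀)) :
    (compFst M₁ M₂).CfgRel (some (Sum.inr M₂.main)) (initList M₁ s)
      (initList (compTM M₁ M₂ e₀) s) := by
  let := M₁.kDecidableEq
  let := M₂.kDecidableEq
  refine ⟨rfl, rfl, ?_⟩
  rw [stk_initList]
  have hid : s.map ((compFst M₁ M₂).symbol M₁.k₀) = s := List.map_id s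
  refine Eq.subst (motive := (compFst M₁ M₂).StkRel _) ?_ ((compFst M₁ M₂).stkRel_single M₁.k₀ s)
  rw [hid]
  exact (stk_initList (compTM M₁ M₂ e₀) s).symm

theorem stkRel_compSnd_of_compFst {u : List (M₂.Γ M₂.k₀)}
    {S : ∀ k, List (Sum.elim M₁.Γ M₂.Γ k)}
    (h : (compFst M₁ M₂).StkRel (haltList M₁ (u.map e₀)).stk S) :
    (compSnd M₁ M₂ e₀).StkRel (initList M₂ u).stk S := by
  let := M₁.kDecidableEq
  let := M₂.kDecidableEq
  rw [stk_haltList] at h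
  have hcast : ∀ j, j = Sum.inl M₁.k₁ → ∀ f : M₂.Γ M₂.k₀ → Sum.elim M₁.Γ M₂.Γ j,
      (∀ x, HEq (f x) (e₀ x)) → update (fun _ => []) j (u.map f) = S := by
    rintro _ rfl f hf
    obtain rfl : f = e₀ := funext fun x => eq_of_heq (hf x)
    have hS := (((compFst M₁ M₂).stkRel_single M₁.k₁ (u.map e₀)).unique h)
    simpa [compFst] using! hS
  rw [stk_initList, ← hcast _ (compStk_k₀ M₁ M₂) _ (compEquiv_heq M₁ M₂ e₀)]
  exact (compSnd M₁ M₂ e₀).stkRel_single M₂.k₀ u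

theorem eq_haltList_of_cfgRel_compSnd {w : List (M₂.Γ M₂.k₁)} {c : (compTM M₁ M₂ e₀).Cfg}
    (h : (compSnd M₁ M₂ e₀).CfgRel none (haltList M₂ w) c) :
    c = haltList (compTM M₁ M₂ e₀) (w.map (compEquiv M₁ M₂ e₀ M₂.k₁)) := by
  let := M₁.kDecidableEq
  let := M₂.kDecidableEq
  obtain ⟨l, v, S⟩ := c
  obtain ⟨hl, hv, hS⟩ := h
  rw [stk_haltList] at hS
  obtain rfl : l = none := hl
  obtain rfl : v = (M₁.initialState, M₂.initialState) := hv
  have hstk := (hS.unique ((compSnd M₁ M₂ e₀).stkRel_single M₂.k₁ w)).trans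
    (stk_haltList (compTM M₁ M₂ e₀) _).symm
  dsimp only at hstk
  rw [hstk]
  rfl

theorem iterate_compTM_step {s : List (M₁.Γ M₁.k₀)} {u : List (M₂.Γ M₂.k₀)}
    {w : List (M₂.Γ M₂.k₁)} {t₁ t₂ : ℕ}
    (h₁ : (flip bind M₁.step)^[t₁] (some (initList M₁ s)) = some (haltList M₁ (u.map e₀)))
    (h₂ : (flip bind M₂.step)^[t₂] (some (initList M₂ u)) = some (haltList M₂ w)) :
    (flip bind (compTM M₁ M₂ e₀).step)^[t₂ + t₁] (some (initList (compTM M₁ M₂ e₀) s)) =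
      some (haltList (compTM M₁ M₂ e₀) (w.map (compEquiv M₁ M₂ e₀ M₂.k₁))) := by
  let := M₁.kDecidableEq
  let := M₂.kDecidableEq
  obtain ⟨d, ⟨hdl, hdv, hdS⟩, hd⟩ := (compFst M₁ M₂).exists_cfgRel_iterate
    (M := M₁.m) (M' := (compTM M₁ M₂ e₀).m) (fin := .goto fun _ => Sum.inr M₂.main)
    (fun _ _ => rfl) (fun _ => rfl) (cfgRel_compFst_initList M₁ M₂ e₀ s) h₁
  have hmid : (compSnd M₁ M₂ e₀).CfgRel none (initList M₂ u) d :=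
    ⟨hdl, hdv, stkRel_compSnd_of_compFst M₁ M₂ e₀ hdS⟩
  obtain ⟨c, hc, hcw⟩ := (compSnd M₁ M₂ e₀).exists_cfgRel_iterate
    (M := M₂.m) (M' := (compTM M₁ M₂ e₀).m) (fin := .halt) (fun _ _ => rfl) (fun _ => rfl)
    hmid h₂
  rw [iterate_add_apply, ← eq_haltList_of_cfgRel_compSnd M₁ M₂ e₀ hc]
  exact (congrArg _ hd).trans hcw

theorem PolyTime.congr {α β β' A B : Type} {ea : α → List A} {eb : β → List B}
    {eb' : β' → List B} {f : α → β} {f' : α → β'} (hf : PolyTime ea eb f)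
    (h : ∀ a, eb (f a) = eb' (f' a)) : PolyTime ea eb' f' := by
  obtain ⟨M⟩ := hf
  exact ⟨⟨M.toTM2ComputableAux, M.time, fun a => h a ▸ M.outputsFun a⟩⟩

theorem PolyTime.comp {α β γ A B C : Type} {ea : α → List A} {eb : β → List B} {ec : γ → List C}
    {f : α → β} {g : β → γ} (hf : PolyTime ea eb f) (hg : PolyTime eb ec g) :
    PolyTime ea ec (g ∘ f) := by
  obtain ⟨h₁⟩ := hf
  obtain ⟨h₂⟩ := hg
  obtain ⟨p, hp⟩ := exists_polynomial_length_le h₁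
  let e₀ := h₂.inputAlphabet.trans h₁.outputAlphabet.symm
  refine ⟨⟨⟨compTM h₁.tm h₂.tm e₀, h₁.inputAlphabet,
    (compEquiv h₁.tm h₂.tm e₀ h₂.tm.k₁).symm.trans h₂.outputAlphabet⟩,
    h₂.time.comp p + h₁.time, fun a => ?_⟩⟩
  obtain ⟨⟨t₁, ht₁⟩, hle₁⟩ := h₁.outputsFun a
  obtain ⟨⟨t₂, ht₂⟩, hle₂⟩ := h₂.outputsFun (f a)
  refine ⟨⟨t₂ + t₁, ?_⟩, ?_⟩
  · have hmid : (eb (f a)).map h₁.outputAlphabet.invFun =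
        ((eb (f a)).map h₂.inputAlphabet.invFun).map e₀ := by
      rw [List.map_map]
      congr 1
      funext x
      simp [e₀]
    exact (iterate_compTM_step h₁.tm h₂.tm e₀ (by rw [← hmid]; exact ht₁) ht₂).trans
      (congrArg (fun l => some (haltList (compTM h₁.tm h₂.tm e₀) l)) List.map_map)
  · have htime := monotone_eval_nat h₂.time (hp a)
    rw [Polynomial.eval_add, Polynomial.eval_comp]
    exact Nat.add_le_add (hle₂.trans htime) hle₁

end Composition

/-! ### Flow charts -/

section FlowChart

/-- The contents of the stacks. -/
abbrev Stk {K : Type} (Γ : K → Type) : Type := ∀ k, List (Γ k)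

/-- An instruction of a flow chart with labels `L`. -/
inductive Instr {K : Type} (Γ : K → Type) (L : Type) : Type
  | push (k : K) (a : Γ k) (next : L)
  | pop (k : K) (next : Option (Γ k) → L)

/-- A flow chart over stacks with labels `Λ`, entered at `entry` and left at the label `none`. Flow
charts are the programs from which the machines of the reduction are assembled. -/
structure FlowChart {K : Type} (Γ : K → Type) where
  Λ : Type
  [fin : Fintype Λ]
  entry : Option Λ
  code : Λ → Instr Γ (Option Λ)

attribute [instance] FlowChart.fin

variable {K : Type} [DecidableEq K] {Γ : K → Type}

/-- The effect of an instruction: the next label and the new stacks. -/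
def Instr.exec {L : Type} (S : Stk Γ) : Instr Γ L → L × Stk Γ
  | .push k a next => (next, update S k (a :: S k))
  | .pop k next => (next (S k).head?, update S k (S k).tail)

/-- Renaming of labels. -/
def Instr.map {L L' : Type} (g : L → L') : Instr Γ L → Instr Γ L'
  | .push k a next => .push k a (g next)
  | .pop k next => .pop k fun o => g (next o)

theorem Instr.exec_map {L L' : Type} (g : L → L') (S : Stk Γ) (i : Instr Γ L) :
    (i.map g).exec S = (g (i.exec S).1, (i.exec S).2) := by
  cases i <;> rfl

namespace FlowChart

/-- One step of a flow chart. -/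
def step (F : FlowChart Γ) : Option F.Λ × Stk Γ → Option F.Λ × Stk Γ
  | (none, S) => (none, S)
  | (some l, S) => (F.code l).exec S

/-- Started with stacks `S`, the flow chart reaches its exit with stacks `S'` in at most `t`
steps. -/
def Runs (F : FlowChart Γ) (S S' : Stk Γ) (t : ℕ) : Prop := F.step^[t] (F.entry, S) = (none, S')

theorem iterate_step_none (F : FlowChart Γ) (S : Stk Γ) (t : ℕ) :
    F.step^[t] (none, S) = (none, S) :=
  iterate_fixed rfl t

theorem Runs.mono {F : FlowChart Γ} {S S' : Stk Γ} {t t' : ℕ} (h : F.Runs S S' t) (ht : t ≤ t') :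
    F.Runs S S' t' := by
  obtain ⟨d, rfl⟩ := Nat.exists_eq_add_of_le' ht
  rw [Runs, iterate_add_apply, h, iterate_step_none]

theorem length_step_le (F : FlowChart Γ) (x : Option F.Λ × Stk Γ) (k : K) :
    ((F.step x).2 k).length ≤ (x.2 k).length + 1 := by
  obtain ⟨_ | l, S⟩ := x
  · exact Nat.le_succ _
  · simp only [step]
    cases F.code l with
    | push k' a next =>
      rcases eq_or_ne k k' with rfl | h
      · simp [Instr.exec]
      · simp [Instr.exec, h]
    | pop k' next =>
      rcases eq_or_ne k k' with rfl | h
      · simp only [Instr.exec, update_self, List.length_tail]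
        lia
      · simp [Instr.exec, h]

theorem Runs.length_le {F : FlowChart Γ} {S S' : Stk Γ} {t : ℕ} (h : F.Runs S S' t) (k : K) :
    (S' k).length ≤ (S k).length + t := by
  have hiter (x : Option F.Λ × Stk Γ) (t : ℕ) :
      ((F.step^[t] x).2 k).length ≤ (x.2 k).length + t := by
    induction t with
    | zero => exact le_rfl
    | succ t ih =>
      rw [iterate_succ_apply']
      exact (F.length_step_le _ k).trans (Nat.succ_le_succ ih)
  have hlen := hiter (F.entry, S) t
  rwa [h] at hlen

theorem exists_iterate_step_of_map {F G : FlowChart Γ} (g : Option F.Λ → Option G.Λ)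
    (hg : ∀ l, ∃ l', g (some l) = some l' ∧ G.code l' = (F.code l).map g) {S' : Stk Γ} {t : ℕ}
    {o : Option F.Λ} {S : Stk Γ} (h : F.step^[t] (o, S) = (none, S')) :
    ∃ t' ≤ t, G.step^[t'] (g o, S) = (g none, S') := by
  induction t generalizing o S with
  | zero =>
    cases h
    exact ⟨0, le_rfl, rfl⟩
  | succ t ih =>
    cases o with
    | none =>
      rw [iterate_step_none] at h
      cases h
      exact ⟨0, Nat.zero_le _, rfl⟩
    | some l =>
      obtain ⟨l', hl', hcode⟩ := hg l
      rw [iterate_succ_apply] at h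
      obtain ⟨t', ht', hG⟩ := ih (o := (F.step (some l, S)).1) (S := (F.step (some l, S)).2) h
      refine ⟨t' + 1, Nat.succ_le_succ ht', ?_⟩
      have hstep : G.step (g (some l), S) = (g (F.step (some l, S)).1, (F.step (some l, S)).2) := by
        simp only [hl', step, hcode, Instr.exec_map]
      rw [iterate_succ_apply, hstep, hG]

/-- The empty flow chart. -/
def skip : FlowChart Γ where
  Λ := Empty
  entry := none
  code := Empty.elim

theorem runs_skip (S : Stk Γ) : (skip : FlowChart Γ).Runs S S 0 := rfl

/-- Push a symbol. -/
def push (k : K) (a : Γ k) : FlowChart Γ where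
  Λ := Unit
  entry := some ()
  code _ := .push k a none

theorem runs_push {k : K} {a : Γ k} {S S' : Stk Γ} (h : update S k (a :: S k) = S') :
    (push k a).Runs S S' 1 := by
  subst h
  rfl

/-- Sequential composition. -/
def seq (F G : FlowChart Γ) : FlowChart Γ where
  Λ := F.Λ ⊕ G.Λ
  entry := F.entry.elim (G.entry.map Sum.inr) (fun l => some (Sum.inl l))
  code := Sum.elim
    (fun l => (F.code l).map fun o => o.elim (G.entry.map Sum.inr) fun l => some (Sum.inl l))
    (fun l => (G.code l).map (Option.map Sum.inr))

theorem Runs.seq {F G : FlowChart Γ} {S S' S'' : Stk Γ} {t t' : ℕ} (h : F.Runs S S' t)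
    (h' : G.Runs S' S'' t') : (F.seq G).Runs S S'' (t + t') := by
  obtain ⟨u, hu, hF⟩ := exists_iterate_step_of_map (G := F.seq G)
    (fun o => o.elim (G.entry.map Sum.inr) fun l => some (Sum.inl l)) (fun l => ⟨_, rfl, rfl⟩) h
  obtain ⟨u', hu', hG⟩ := exists_iterate_step_of_map (G := F.seq G) (Option.map Sum.inr)
    (fun l => ⟨_, rfl, rfl⟩) h'
  refine Runs.mono (t := u' + u) ?_ (by lia)
  rw [Runs, iterate_add_apply]
  exact (congrArg _ hF).trans hG

/-- Repeat: pop a symbol `a` from the stack `k` (and leave the loop if there is none), run `body a`,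
and leave the loop if `cont a` is false. -/
def loop (k : K) [Fintype (Γ k)] (cont : Γ k → Bool) (body : Γ k → FlowChart Γ) : FlowChart Γ where
  Λ := Option (Σ a, (body a).Λ)
  entry := some none
  code := fun
    | none => .pop k fun o => o.elim none fun a =>
        (body a).entry.elim (if cont a then some none else none) fun l => some (some ⟨a, l⟩)
    | some ⟨a, l⟩ => ((body a).code l).map fun o =>
        o.elim (if cont a then some none else none) fun l => some (some ⟨a, l⟩)

section Loop

variable {k : K} [Fintype (Γ k)] {cont : Γ k → Bool} {body : Γ k → FlowChart Γ}

theorem runs_loop_nil {S : Stk Γ} (h : S k = []) : (loop k cont body).Runs S S 1 := by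
  change ((S k).head?.elim none _, update S k (S k).tail) = _
  rw [h]
  exact congrArg (Prod.mk none) (by rw [List.tail_nil, ← h, update_eq_self])

theorem exists_iterate_loop_step {S S' : Stk Γ} {a : Γ k} {l : List (Γ k)} {t : ℕ}
    (h : S k = a :: l) (hb : (body a).Runs (update S k l) S' t) :
    ∃ u ≤ t + 1, (loop k cont body).step^[u] (some none, S) =
      (if cont a then some none else none, S') := by
  obtain ⟨u, hu, hbody⟩ := exists_iterate_step_of_map (G := loop k cont body)
    (fun o => o.elim (if cont a then some none else none) fun l => some (some ⟨a, l⟩))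
    (fun l => ⟨_, rfl, rfl⟩) hb
  refine ⟨u + 1, by lia, ?_⟩
  rw [iterate_succ_apply]
  refine Eq.trans ?_ hbody
  simp only [step, loop, Instr.exec, h]
  rfl

theorem runs_loop_exit {S S' : Stk Γ} {a : Γ k} {l : List (Γ k)} {t : ℕ} (h : S k = a :: l)
    (hc : cont a = false) (hb : (body a).Runs (update S k l) S' t) :
    (loop k cont body).Runs S S' (t + 1) := by
  obtain ⟨u, hu, hround⟩ := exists_iterate_loop_step (cont := cont) h hb
  rw [hc] at hround
  exact Runs.mono hround hu

theorem runs_loop_cons {S S' S'' : Stk Γ} {a : Γ k} {l : List (Γ k)} {t t' : ℕ} (h : S k = a :: l)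
    (hc : cont a = true) (hb : (body a).Runs (update S k l) S' t)
    (h' : (loop k cont body).Runs S' S'' t') :
    (loop k cont body).Runs S S'' (t + 1 + t') := by
  obtain ⟨u, hu, hround⟩ := exists_iterate_loop_step (cont := cont) h hb
  rw [hc] at hround
  refine Runs.mono (t := t' + u) ?_ (by lia)
  rw [Runs, iterate_add_apply]
  exact (congrArg _ hround).trans h'

theorem runs_loop_iterate {x : Γ k} (St : ℕ → ℕ → Stk Γ) {t : ℕ} (hc : cont x = true)
    (hb : ∀ i r, ∃ l, St i (r + 1) k = x :: l ∧
      (body x).Runs (update (St i (r + 1)) k l) (St (i + 1) r) t) {S : Stk Γ} {u : ℕ} (i r : ℕ)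
    (h : (loop k cont body).Runs (St (i + r) 0) S u) :
    (loop k cont body).Runs (St i r) S (r * (t + 1) + u) := by
  induction r generalizing i with
  | zero => exact h.mono (by lia)
  | succ r ih =>
    obtain ⟨l, hl, hbody⟩ := hb i r
    refine (runs_loop_cons hl hc hbody (ih (i + 1) ?_)).mono ?_
    · rwa [Nat.add_right_comm, Nat.add_assoc]
    · rw [Nat.succ_mul]
      lia

theorem runs_loop_replicate {x : Γ k} (St : ℕ → ℕ → Stk Γ) {t : ℕ} (hc : cont x = true)
    (hb : ∀ i r, ∃ l, St i (r + 1) k = x :: l ∧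
      (body x).Runs (update (St i (r + 1)) k l) (St (i + 1) r) t) (r : ℕ)
    (h0 : St r 0 k = []) :
    (loop k cont body).Runs (St 0 r) (St r 0) (r * (t + 1) + 1) := by
  refine runs_loop_iterate St hc hb 0 r ?_
  rw [Nat.zero_add]
  exact runs_loop_nil h0

/- The stacks other than `k` hold a value `x : X`. The invariant `I` may depend on what is left of
the stack `k`. -/
theorem runs_loop_foldl {X : Type} (St : X → List (Γ k) → Stk Γ) (f : X → Γ k → X)
    (I : X → List (Γ k) → Prop) {t : ℕ} (hk : ∀ x l, St x l k = l)
    (hu : ∀ x l l', update (St x l) k l' = St x l')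
    (hb : ∀ x a l, I x (a :: l) → cont a = true ∧ I (f x a) l ∧
      (body a).Runs (St x l) (St (f x a) l) t) (l : List (Γ k)) (x : X) (hx : I x l) :
    (loop k cont body).Runs (St x l) (St (l.foldl f x) []) (l.length * (t + 1) + 1) := by
  induction l generalizing x with
  | nil => exact (runs_loop_nil (hk x [])).mono (by lia)
  | cons a l ih =>
    obtain ⟨hcont, hI, hbody⟩ := hb x a l hx
    refine (runs_loop_cons (hk x (a :: l)) hcont (by rwa [hu]) (ih _ hI)).mono ?_
    rw [List.length_cons, Nat.succ_mul]
    lia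

theorem runs_loop_reverse (St : List (Γ k) → List (Γ k) → Stk Γ) {t : ℕ}
    (hk : ∀ d l, St d l k = l) (hu : ∀ d l l', update (St d l) k l' = St d l')
    (hc : ∀ a, cont a = true) (hb : ∀ a d l, (body a).Runs (St d l) (St (a :: d) l) t)
    (d l : List (Γ k)) :
    (loop k cont body).Runs (St d l) (St (l.reverse ++ d) []) (l.length * (t + 1) + 1) := by
  rw [← List.foldl_flip_cons_eq_append']
  exact runs_loop_foldl St (fun d a => a :: d) (fun _ _ => True) hk hu
    (fun d a l _ => ⟨hc a, trivial, hb a d l⟩) l d trivial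

theorem runs_loop_skip {S S' : Stk Γ} {t : ℕ} (hS : update S k [] = S') (ht : (S k).length ≤ t) :
    (loop k (fun _ => true) fun _ => skip : FlowChart Γ).Runs S S' (t + 1) := by
  have h := runs_loop_foldl (k := k) (cont := fun _ => true) (body := fun _ => (skip : FlowChart Γ))
    (X := Unit) (fun _ l => update S k l) (fun _ _ => ()) (fun _ _ => True) (t := 0)
    (fun _ _ => update_self ..) (fun _ _ _ => update_idem ..)
    (fun _ _ _ _ => ⟨rfl, trivial, runs_skip _⟩) (S k) () trivial
  rw [update_eq_self, hS] at h
  exact h.mono (by lia)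

end Loop

/-- Push the symbols of a list, so that the last one is on top. -/
def pushes (k : K) : List (Γ k) → FlowChart Γ
  | [] => skip
  | a :: l => (push k a).seq (pushes k l)

theorem runs_pushes {k : K} (l : List (Γ k)) {S S' : Stk Γ}
    (h : update S k (l.reverse ++ S k) = S') : (pushes k l).Runs S S' l.length := by
  induction l generalizing S with
  | nil =>
    rw [List.reverse_nil, List.nil_append, update_eq_self] at h
    exact h ▸ runs_skip S
  | cons a l ih =>
    refine Runs.mono ((runs_push rfl).seq (ih ?_)) (by rw [List.length_cons, add_comm])
    simpa using h

/-- Sequential composition of a list of flow charts. -/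
def seqs : List (FlowChart Γ) → FlowChart Γ
  | [] => skip
  | F :: l => F.seq (seqs l)

end FlowChart

section Machine

/-- The next label, as a function of the symbol that was popped. -/
def popNext {L : Type} (k : K) (next : Option (Γ k) → L) (v : Option (Σ k, Γ k)) : L :=
  next (v.bind fun s => if h : s.1 = k then some (h ▸ s.2) else none)

/-- The statement for an instruction. The internal state is the symbol that was popped last. -/
def Instr.toStmt {L : Type} : Instr Γ L → TM2.Stmt Γ L (Option (Σ k, Γ k))
  | .push k a next => .push k (fun _ => a) (.goto fun _ => next)
  | .pop k next => .pop k (fun _ o => o.map (Sigma.mk k)) (.goto (popNext k next))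

theorem Instr.exists_stepAux_toStmt {L : Type} (i : Instr Γ L) (v : Option (Σ k, Γ k))
    (S : Stk Γ) :
    ∃ v', TM2.stepAux i.toStmt v S = ⟨some (i.exec S).1, v', (i.exec S).2⟩ := by
  cases i with
  | push k a next => exact ⟨_, rfl⟩
  | pop k next =>
    refine ⟨(S k).head?.map (Sigma.mk k), ?_⟩
    simp only [Instr.toStmt, TM2.stepAux, Instr.exec, popNext]
    congr 3
    cases (S k).head? <;> simp

variable [Fintype K] [∀ k, Fintype (Γ k)]

namespace FlowChart

/-- The machine of a flow chart with input stack `k₀` and output stack `k₁`. -/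
def toTM (F : FlowChart Γ) (k₀ k₁ : K) : FinTM2 where
  K := K
  k₀ := k₀
  k₁ := k₁
  Γ := Γ
  Λ := Option F.Λ
  main := F.entry
  σ := Option (Σ k, Γ k)
  initialState := none
  m := fun
    | none => .load (fun _ => none) .halt
    | some l => (F.code l).toStmt

theorem exists_iterate_toTM_step (F : FlowChart Γ) (k₀ k₁ : K) {t : ℕ} {l : Option F.Λ}
    (v : Option (Σ k, Γ k)) {S S' : Stk Γ} (h : F.step^[t] (l, S) = (none, S')) :
    ∃ t' ≤ t + 1, (flip bind (F.toTM k₀ k₁).step)^[t']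
      (some (⟨some l, v, S⟩ : TM2.Cfg Γ (Option F.Λ) (Option (Σ k, Γ k)))) =
      some (⟨none, none, S'⟩ : TM2.Cfg Γ (Option F.Λ) (Option (Σ k, Γ k))) := by
  induction t generalizing l v S with
  | zero =>
    cases h
    exact ⟨1, le_rfl, rfl⟩
  | succ t ih =>
    cases l with
    | none =>
      rw [FlowChart.iterate_step_none] at h
      cases h
      exact ⟨1, by lia, rfl⟩
    | some l =>
      rw [iterate_succ_apply] at h
      obtain ⟨v', hv'⟩ := (F.code l).exists_stepAux_toStmt v S
      obtain ⟨t', ht', hrest⟩ := ih v' h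
      refine ⟨t' + 1, by lia, ?_⟩
      rw [iterate_succ_apply]
      exact (congrArg _ (congrArg some hv')).trans hrest

theorem polyTime (F : FlowChart Γ) (k₀ k₁ : K) {α β : Type} {ea : α → List (Γ k₀)}
    {eb : β → List (Γ k₁)} {f : α → β} (p : Polynomial ℕ)
    (h : ∀ a, F.Runs (update (fun _ => []) k₀ (ea a)) (update (fun _ => []) k₁ (eb (f a)))
      (p.eval (ea a).length)) : PolyTime ea eb f := by
  refine ⟨⟨⟨F.toTM k₀ k₁, Equiv.refl _, Equiv.refl _⟩, p + 1, fun a => ?_⟩⟩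
  have hex := F.exists_iterate_toTM_step k₀ k₁ none (h a)
  have hid (k : K) (l : List (Γ k)) : l.map (Equiv.refl (Γ k)).invFun = l := List.map_id l
  have hinit : initList (F.toTM k₀ k₁) (ea a) =
      ⟨some F.entry, none, update (fun _ => []) k₀ (ea a)⟩ :=
    congrArg (TM2.Cfg.mk _ _) (stk_initList (F.toTM k₀ k₁) (ea a))
  have hhalt : haltList (F.toTM k₀ k₁) (eb (f a)) =
      ⟨none, none, update (fun _ => []) k₁ (eb (f a))⟩ :=
    congrArg (TM2.Cfg.mk _ _) (stk_haltList (F.toTM k₀ k₁) (eb (f a)))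
  refine ⟨⟨hex.choose, ?_⟩, by simpa using hex.choose_spec.1⟩
  exact (congrArg _ (congrArg some ((congrArg _ (hid k₀ _)).trans hinit))).trans
    (hex.choose_spec.2.trans (congrArg some ((congrArg _ (hid k₁ _)).trans hhalt).symm))

end FlowChart

end Machine

end FlowChart

/-! ### From strings of gates to strings of monomials -/

/-- Alphabet for circuits over Hadamard, Z, CZ and CCZ gates. The symbols `vo`, `vc` enclose an
argument of a diagonal gate, `fo`, `fc` a diagonal gate, and `ho`, `hc` the argument of a Hadamard
gate, so that the reverse of a string of gates is again one, up to the exchange of these symbols.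
The symbol `wire` stands for an additional qubit. -/
inductive Sym : Type
  | tick | wire | vo | vc | ho | hc | fo | fc
  deriving DecidableEq

instance : Fintype Sym where
  elems := {.tick, .wire, .vo, .vc, .ho, .hc, .fo, .fc}
  complete := by rintro ⟨⟩ <;> decide

instance : Fintype PolySym where
  elems := ⟨↑[PolySym.tick, .comma, .semicolon], by simp⟩
  complete := by rintro ⟨⟩ <;> simp

/-- The state of the assembler, which turns a string of gates into a polynomial. -/
structure Asm where
  /-- the argument that is being read -/
  arg : ℕ
  /-- the number of variables -/
  n : ℕ
  /-- the variables of the current segments of the wires -/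
  cur : List ℕ
  /-- the monomials -/
  out : List PolySym

/-- Reading a symbol. -/
def Asm.step (s : Asm) : Sym → Asm
  | .tick => { s with arg := s.arg + 1 }
  | .wire => { s with cur := s.n :: s.cur, n := s.n + 1 }
  | .vc => { s with arg := 0, out := s.out ++ s.cur[s.arg]?.elim [] PolySym.num }
  | .hc => match s.cur[s.arg]? with
    | none => { s with arg := 0 }
    | some c =>
      { arg := 0
        n := s.n + 1
        cur := s.cur.set s.arg s.n
        out := s.out ++ (PolySym.num c ++ PolySym.num s.n ++ [.semicolon]) }
  | .fc => { s with out := s.out ++ [.semicolon] }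
  | .vo | .ho | .fo => s

/-- The string for the polynomial of the circuit that is described by a string of gates. -/
def assemble (w : List Sym) : List PolySym :=
  let s := w.foldl Asm.step ⟨0, 0, [], []⟩
  PolySym.num s.n ++ s.out

/-- The stacks of the assembler. -/
inductive AsmStack : Type
  | inp | out | rev | arg | tmp | vars | cur | past
  deriving DecidableEq

instance : Fintype AsmStack where
  elems := {.inp, .out, .rev, .arg, .tmp, .vars, .cur, .past}
  complete := by rintro ⟨⟩ <;> decide

/-- The alphabets of the stacks of the assembler. -/
def AsmΓ : AsmStack → Type
  | .inp => Sym
  | .out | .rev => PolySym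
  | .arg | .tmp | .vars => Unit
  | .cur | .past => Bool

instance (k : AsmStack) : Fintype (AsmΓ k) := by
  cases k <;> unfold AsmΓ <;> infer_instance

/-- Stack contents of the assembler. -/
def asmStk (inp : List Sym) (out rev : List PolySym) (a t n : ℕ) (d e : List Bool) : Stk AsmΓ
  | .inp => inp
  | .out => out
  | .rev => rev
  | .arg => List.replicate a ()
  | .tmp => List.replicate t ()
  | .vars => List.replicate n ()
  | .cur => d
  | .past => e

theorem PolySym.reverse_num (c : ℕ) :
    (PolySym.num c).reverse = .comma :: List.replicate c .tick := by
  simp [PolySym.num]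

theorem PolySym.length_num (c : ℕ) : (PolySym.num c).length = c + 1 := by
  simp [PolySym.num]

namespace Asm

open FlowChart

/-- A number in unary on a stack of the assembler. -/
def bits (c : ℕ) : List Bool := List.replicate c true ++ [false]

/-- The variables of a list of segments on a stack of the assembler. -/
def enc (cur : List ℕ) : List Bool := cur.flatMap bits

@[simp] theorem enc_nil : enc [] = [] := rfl

@[simp] theorem enc_cons (c : ℕ) (l : List ℕ) : enc (c :: l) = bits c ++ enc l := rfl

theorem enc_append (l l' : List ℕ) : enc (l ++ l') = enc l ++ enc l' := List.flatMap_append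

theorem reverse_bits (c : ℕ) : (bits c).reverse = false :: List.replicate c true := by
  simp [bits]

theorem length_enc_le {l : List ℕ} {b : ℕ} (h : ∀ c ∈ l, c ≤ b) :
    (enc l).length ≤ l.length * (b + 1) := by
  induction l with
  | nil => exact Nat.zero_le _
  | cons c l ih =>
    have hl := ih fun c hc => h c (List.mem_cons_of_mem _ hc)
    have hc := h c List.mem_cons_self
    simp only [enc_cons, bits, List.length_append, List.length_replicate, List.length_cons,
      List.length_nil, Nat.succ_mul]
    lia

section Stacks

variable {inp : List Sym} {out rev : List PolySym} {a t n : ℕ} {d e : List Bool}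

theorem update_inp {x : List Sym} : update (asmStk inp out rev a t n d e) .inp x =
    asmStk x out rev a t n d e := by
  funext k; cases k <;> rfl

theorem update_rev {x : List PolySym} : update (asmStk inp out rev a t n d e) .rev x =
    asmStk inp out x a t n d e := by
  funext k; cases k <;> rfl

theorem update_arg {x : ℕ} : update (asmStk inp out rev a t n d e) .arg (List.replicate x ()) =
    asmStk inp out rev x t n d e := by
  funext k; cases k <;> rfl

theorem update_tmp {x : ℕ} : update (asmStk inp out rev a t n d e) .tmp (List.replicate x ()) =
    asmStk inp out rev a x n d e := by
  funext k; cases k <;> rfl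

theorem update_vars {x : ℕ} : update (asmStk inp out rev a t n d e) .vars (List.replicate x ()) =
    asmStk inp out rev a t x d e := by
  funext k; cases k <;> rfl

theorem update_cur {x : List Bool} : update (asmStk inp out rev a t n d e) .cur x =
    asmStk inp out rev a t n x e := by
  funext k; cases k <;> rfl

theorem update_past {x : List Bool} : update (asmStk inp out rev a t n d e) .past x =
    asmStk inp out rev a t n d x := by
  funext k; cases k <;> rfl

theorem runs_push_out (x : PolySym) : (push .out x : FlowChart AsmΓ).Runs
    (asmStk inp out rev a t n d e) (asmStk inp (x :: out) rev a t n d e) 1 :=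
  runs_push (by funext k; cases k <;> rfl)

theorem runs_push_rev (x : PolySym) : (push .rev x : FlowChart AsmΓ).Runs
    (asmStk inp out rev a t n d e) (asmStk inp out (x :: rev) a t n d e) 1 :=
  runs_push update_rev

theorem runs_push_arg : (push .arg () : FlowChart AsmΓ).Runs
    (asmStk inp out rev a t n d e) (asmStk inp out rev (a + 1) t n d e) 1 :=
  runs_push (update_arg (x := a + 1))

theorem runs_push_tmp : (push .tmp () : FlowChart AsmΓ).Runs
    (asmStk inp out rev a t n d e) (asmStk inp out rev a (t + 1) n d e) 1 :=
  runs_push (update_tmp (x := t + 1))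

theorem runs_push_vars : (push .vars () : FlowChart AsmΓ).Runs
    (asmStk inp out rev a t n d e) (asmStk inp out rev a t (n + 1) d e) 1 :=
  runs_push (update_vars (x := n + 1))

theorem runs_push_cur (x : Bool) : (push .cur x : FlowChart AsmΓ).Runs
    (asmStk inp out rev a t n d e) (asmStk inp out rev a t n (x :: d) e) 1 :=
  runs_push update_cur

theorem runs_push_past (x : Bool) : (push .past x : FlowChart AsmΓ).Runs
    (asmStk inp out rev a t n d e) (asmStk inp out rev a t n d (x :: e)) 1 :=
  runs_push update_past

/-- Run `F` once for each variable. -/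
def forVars (F : FlowChart AsmΓ) : FlowChart AsmΓ :=
  (loop .vars (fun _ => true) fun _ => (push .tmp ()).seq F).seq
    (loop .tmp (fun _ => true) fun _ => push .vars ())

theorem runs_forVars {F : FlowChart AsmΓ} (rev : ℕ → List PolySym) (d e : ℕ → List Bool) {u : ℕ}
    (h : ∀ i n t, F.Runs (asmStk inp out (rev i) a t n (d i) (e i))
      (asmStk inp out (rev (i + 1)) a t n (d (i + 1)) (e (i + 1))) u) (n : ℕ) :
    (forVars F).Runs (asmStk inp out (rev 0) a 0 n (d 0) (e 0))
      (asmStk inp out (rev n) a 0 n (d n) (e n)) (n * (u + 4) + 2) := by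
  refine Runs.mono (Runs.seq
    (runs_loop_replicate (k := AsmStack.vars) (x := ())
      (fun i r => asmStk inp out (rev i) a i r (d i) (e i)) rfl (t := 1 + u)
      (fun i r => ⟨List.replicate r (), rfl, ?_⟩) n rfl)
    (runs_loop_replicate (k := AsmStack.tmp) (x := ())
      (fun i r => asmStk inp out (rev n) a r i (d n) (e n)) rfl (t := 1)
      (fun i r => ⟨List.replicate r (), rfl, ?_⟩) n rfl)) ?_
  · rw [update_vars]
    exact runs_push_tmp.seq (h i r (i + 1))
  · rw [update_tmp]
    exact runs_push_vars
  · ring_nf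
    lia

/-- Move an entry of `cur` to `past`. -/
def move : FlowChart AsmΓ := loop .cur (fun b : Bool => b) fun b => push .past b

theorem runs_move (c : ℕ) :
    move.Runs (asmStk inp out rev a t n (bits c ++ d) e)
      (asmStk inp out rev a t n d ((bits c).reverse ++ e)) (2 * c + 2) := by
  refine Runs.mono (runs_loop_iterate (k := AsmStack.cur) (x := true)
    (fun i r => asmStk inp out rev a t n (bits r ++ d) (List.replicate i true ++ e))
    (t := 1) rfl (fun i r => ⟨bits r ++ d, rfl, ?_⟩) 0 c
    (runs_loop_exit (k := AsmStack.cur) (a := false) (l := d) (t := 1) rfl rfl ?_)) (by lia)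
  · rw [update_cur]
    exact runs_push_past _
  · rw [update_cur, reverse_bits, Nat.zero_add]
    exact runs_push_past _

/-- Move the entries of `cur` that precede the one with number `arg` to `past`. -/
def seek : FlowChart AsmΓ := loop .arg (fun _ => true) fun _ => move

theorem runs_seek {b : ℕ} {cur : List ℕ} (hb : ∀ c ∈ cur, c ≤ b) :
    seek.Runs (asmStk inp out rev a t n (enc cur) e)
      (asmStk inp out rev 0 t n (enc (cur.drop a)) ((enc (cur.take a)).reverse ++ e))
      (a * (2 * b + 3) + 1) := by
  induction a generalizing cur e with
  | zero => exact (runs_loop_nil rfl).mono (by lia)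
  | succ a ih =>
    cases cur with
    | nil =>
      have hrest := ih (e := e) hb
      rw [List.drop_nil, List.take_nil] at hrest
      refine (runs_loop_cons (k := AsmStack.arg) (a := ()) (l := List.replicate a ()) rfl rfl
        (t := 1) (S' := asmStk inp out rev a t n (enc []) e) ?_ hrest).mono (by lia)
      rw [update_arg]
      exact runs_loop_nil rfl
    | cons c cur =>
      have hrest := ih (e := (bits c).reverse ++ e) fun c hc => hb c (List.mem_cons_of_mem _ hc)
      have hc := hb c List.mem_cons_self
      rw [List.take_succ_cons, enc_cons, enc_cons, List.reverse_append, List.append_assoc]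
      refine (runs_loop_cons (k := AsmStack.arg) (a := ()) (l := List.replicate a ()) rfl rfl
        (t := 2 * c + 2) ?_ hrest).mono (by lia)
      rw [update_arg]
      exact runs_move c

/-- Move everything from `past` to `cur`. -/
def rewind : FlowChart AsmΓ := loop .past (fun _ => true) fun b : Bool => push .cur b

theorem runs_rewind :
    rewind.Runs (asmStk inp out rev a t n d e) (asmStk inp out rev a t n (e.reverse ++ d) [])
      (e.length * 2 + 1) := by
  exact runs_loop_reverse (k := AsmStack.past) (fun d e => asmStk inp out rev a t n d e)
    (fun _ _ => rfl) (fun _ _ _ => update_past) (fun _ => rfl) (fun _ _ _ => runs_push_cur _) d e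

/-- Run `F` on the entries of `cur` from the one with number `arg` on. -/
def atArg (F : FlowChart AsmΓ) : FlowChart AsmΓ := seek.seq (F.seq rewind)

theorem runs_atArg {F : FlowChart AsmΓ} {b n' u : ℕ} {rev' : List PolySym} {cur l : List ℕ}
    (hF : F.Runs (asmStk inp out rev 0 t n (enc (cur.drop a)) (enc (cur.take a)).reverse)
      (asmStk inp out rev' 0 t n' d ((enc l).reverse ++ (enc (cur.take a)).reverse)) u)
    (ha : a ≤ b) (hcur : ∀ c ∈ cur, c ≤ b) (hl : ∀ c ∈ l, c ≤ b)
    (hll : l.length ≤ 1) :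
    (atArg F).Runs (asmStk inp out rev a t n (enc cur) [])
      (asmStk inp out rev' 0 t n' (enc (cur.take a ++ l) ++ d) [])
      (u + (4 * b + 4) * (b + 2)) := by
  have hseek := runs_seek (inp := inp) (out := out) (rev := rev) (t := t) (n := n) (a := a)
    (e := []) hcur
  rw [List.append_nil] at hseek
  have h := hseek.seq (hF.seq runs_rewind)
  rw [← List.reverse_append, ← enc_append, List.reverse_reverse] at h
  refine h.mono ?_
  have henc := length_enc_le (l := cur.take a ++ l) fun c hc =>
    (List.mem_append.1 hc).elim (fun hc => hcur c (List.mem_of_mem_take hc)) (hl c)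
  have htake : (cur.take a ++ l).length ≤ b + 1 := by
    rw [List.length_append, List.length_take]
    lia
  rw [List.length_reverse]
  nlinarith

/-- Move an entry from `cur` to `past` and write it on `rev`. -/
def fetch : FlowChart AsmΓ :=
  loop .cur (fun b : Bool => b) fun b : Bool =>
    (push .past b).seq (push .rev (if b then PolySym.tick else PolySym.comma))

theorem runs_fetch_nil : fetch.Runs (asmStk inp out rev a t n [] e)
    (asmStk inp out rev a t n [] e) 1 :=
  runs_loop_nil rfl

theorem runs_fetch_cons (c : ℕ) :
    fetch.Runs (asmStk inp out rev a t n (bits c ++ d) e)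
      (asmStk inp out ((PolySym.num c).reverse ++ rev) a t n d ((bits c).reverse ++ e))
      (3 * c + 3) := by
  refine Runs.mono (runs_loop_iterate (k := AsmStack.cur) (x := true)
    (fun i r => asmStk inp out (List.replicate i PolySym.tick ++ rev) a t n (bits r ++ d)
      (List.replicate i true ++ e))
    (t := 2) rfl (fun i r => ⟨bits r ++ d, rfl, ?_⟩) 0 c
    (runs_loop_exit (k := AsmStack.cur) (a := false) (l := d) (t := 2) rfl rfl ?_)) (by lia)
  · rw [update_cur]
    exact (runs_push_past _).seq (runs_push_rev _)
  · rw [update_cur, reverse_bits, PolySym.reverse_num, Nat.zero_add]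
    exact (runs_push_past _).seq (runs_push_rev _)

/-- Processing a symbol of an entry of `cur`; at its end, a new variable is written on `rev` and put
on `past`. -/
def renewBody : Bool → FlowChart AsmΓ
  | true => push .rev PolySym.tick
  | false => (push .rev PolySym.comma).seq
      ((forVars ((push .rev PolySym.tick).seq (push .past true))).seq ((push .past false).seq
        ((push .rev PolySym.comma).seq ((push .rev PolySym.semicolon).seq (push .vars ())))))

theorem runs_renewBody_false :
    (renewBody false).Runs (asmStk inp out rev a 0 n d e)
      (asmStk inp out (.semicolon :: ((PolySym.num n).reverse ++ .comma :: rev)) a 0 (n + 1) d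
        ((bits n).reverse ++ e)) (6 * n + 7) := by
  have hvars := runs_forVars (inp := inp) (out := out) (a := a)
    (F := (push .rev PolySym.tick).seq (push .past true)) (u := 2)
    (fun i => List.replicate i .tick ++ .comma :: rev) (fun _ => d)
    (fun i => List.replicate i true ++ e)
    (fun i n t => (runs_push_rev _).seq (runs_push_past _)) n
  have h := (runs_push_rev .comma).seq (hvars.seq ((runs_push_past false).seq
    ((runs_push_rev .comma).seq ((runs_push_rev .semicolon).seq runs_push_vars))))
  rw [reverse_bits, PolySym.reverse_num]
  exact h.mono (by lia)

/-- Replace an entry of `cur` by a new variable, and write the monomial of a Hadamard gate on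
`rev`. -/
def renew : FlowChart AsmΓ := loop .cur (fun b : Bool => b) renewBody

theorem runs_renew_nil :
    renew.Runs (asmStk inp out rev a t n [] e) (asmStk inp out rev a t n [] e) 1 :=
  runs_loop_nil rfl

theorem runs_renew_cons (c : ℕ) :
    renew.Runs (asmStk inp out rev a 0 n (bits c ++ d) e)
      (asmStk inp out ((PolySym.num c ++ PolySym.num n ++ [PolySym.semicolon]).reverse ++ rev) a 0
        (n + 1) d ((bits n).reverse ++ e)) (c * 2 + (6 * n + 8)) := by
  refine runs_loop_iterate (k := AsmStack.cur) (cont := fun b : Bool => b) (x := true)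
    (fun i r => asmStk inp out (List.replicate i .tick ++ rev) a 0 n (bits r ++ d) e)
    (t := 1) rfl (fun i r => ⟨bits r ++ d, rfl, ?_⟩) 0 c
    (runs_loop_exit (k := AsmStack.cur) (a := false) (l := d) rfl rfl ?_)
  · rw [update_cur]
    exact runs_push_rev _
  · rw [update_cur, Nat.zero_add]
    convert! runs_renewBody_false using 2
    simp [PolySym.reverse_num]

end Stacks

/-- Processing a symbol. -/
def flow : Sym → FlowChart AsmΓ
  | .tick => push .arg ()
  | .wire => (push .cur false).seq ((forVars (push .cur true)).seq (push .vars ()))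
  | .vc => atArg fetch
  | .hc => atArg renew
  | .fc => push .rev PolySym.semicolon
  | .vo | .ho | .fo => skip

/-- The stacks that represent a state of the assembler. -/
def stk (s : Asm) (inp : List Sym) : Stk AsmΓ :=
  asmStk inp [] s.out.reverse s.arg 0 s.n (enc s.cur) []

/-- An invariant of the assembler, for an input of length `L` of which `r` symbols are left. -/
structure Inv (L r : ℕ) (s : Asm) : Prop where
  arg_le : s.arg + r ≤ L
  length_cur_le : s.cur.length + r ≤ L
  n_le : s.n + r ≤ L
  cur_lt : ∀ c ∈ s.cur, c < s.n
  length_out_le : s.out.length + r * (2 * L + 3) ≤ L * (2 * L + 3)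

/-- A bound for the time that the assembler takes to process a symbol. -/
def symTime (L : ℕ) : ℕ := 8 * L + 9 + (4 * L + 4) * (L + 2)

section Step

variable {L r : ℕ} {s : Asm}

theorem Inv.cur_le (h : s.Inv L r) : ∀ c ∈ s.cur, c ≤ L := fun c hc => by
  have := h.cur_lt c hc
  have := h.n_le
  lia

theorem Inv.runs_flow_vc (h : s.Inv L r) (inp : List Sym) :
    (flow .vc).Runs (s.stk inp) ((s.step .vc).stk inp) (symTime L) := by
  have hcur := h.cur_le
  obtain ⟨ha, hlen, hn, -, -⟩ := h
  obtain ⟨a, n, cur, out⟩ := s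
  cases hc : cur[a]? with
  | none =>
    have hdrop : cur.drop a = [] := List.drop_eq_nil_iff.2 (List.getElem?_eq_none_iff.1 hc)
    have hF := runs_fetch_nil (inp := inp) (out := []) (rev := out.reverse) (a := 0) (t := 0)
      (n := n) (e := (enc (cur.take a)).reverse)
    rw [← enc_nil, ← hdrop] at hF
    convert! (runs_atArg (l := []) hF (b := L) (by lia) hcur (by simp) (by simp)).mono
      (show _ ≤ symTime L by unfold symTime; lia) using 1
    simp [stk, step, hc, ← enc_append]
  | some c =>
    obtain ⟨hlt, rfl⟩ := List.getElem?_eq_some_iff.1 hc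
    have hcL := hcur _ (List.getElem_mem hlt)
    have hdrop := List.drop_eq_getElem_cons hlt
    have hF := runs_fetch_cons (inp := inp) (out := []) (rev := out.reverse) (a := 0) (t := 0)
      (n := n) (d := enc (cur.drop (a + 1))) (e := (enc (cur.take a)).reverse) cur[a]
    rw [← enc_cons, ← hdrop, ← List.append_nil (bits _), ← enc_nil, ← enc_cons] at hF
    convert! (runs_atArg hF (b := L) (by lia) hcur (by simpa using hcL) (by simp)).mono
      (show _ ≤ symTime L by unfold symTime; lia) using 1
    simp [stk, step, hc, ← enc_append]

theorem Inv.runs_flow_hc (h : s.Inv L r) (inp : List Sym) :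
    (flow .hc).Runs (s.stk inp) ((s.step .hc).stk inp) (symTime L) := by
  have hcur := h.cur_le
  obtain ⟨ha, hlen, hn, -, -⟩ := h
  obtain ⟨a, n, cur, out⟩ := s
  cases hc : cur[a]? with
  | none =>
    have hdrop : cur.drop a = [] := List.drop_eq_nil_iff.2 (List.getElem?_eq_none_iff.1 hc)
    have hF := runs_renew_nil (inp := inp) (out := []) (rev := out.reverse) (a := 0) (t := 0)
      (n := n) (e := (enc (cur.take a)).reverse)
    rw [← enc_nil, ← hdrop] at hF
    convert! (runs_atArg (l := []) hF (b := L) (by lia) hcur (by simp) (by simp)).mono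
      (show _ ≤ symTime L by unfold symTime; lia) using 1
    simp [stk, step, hc, ← enc_append]
  | some c =>
    obtain ⟨hlt, rfl⟩ := List.getElem?_eq_some_iff.1 hc
    have hcL := hcur _ (List.getElem_mem hlt)
    have hdrop := List.drop_eq_getElem_cons hlt
    have hF := runs_renew_cons (inp := inp) (out := []) (rev := out.reverse) (a := 0)
      (n := n) (d := enc (cur.drop (a + 1))) (e := (enc (cur.take a)).reverse) cur[a]
    rw [← enc_cons, ← hdrop, ← List.append_nil (bits n), ← enc_nil, ← enc_cons] at hF
    convert! (runs_atArg hF (b := L) (by lia) hcur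
      (by simpa using (Nat.le_add_right n r).trans hn) (by simp)).mono
      (show _ ≤ symTime L by unfold symTime; lia) using 1
    simp [stk, step, List.set_eq_take_append_cons_drop, hlt, enc_append]

theorem Inv.runs_flow (h : s.Inv L r) (inp : List Sym) (x : Sym) :
    (flow x).Runs (s.stk inp) ((s.step x).stk inp) (symTime L) := by
  have hpos : 1 ≤ symTime L := by unfold symTime; lia
  cases x with
  | tick => exact runs_push_arg.mono hpos
  | wire =>
    have hrun := (runs_push_cur false).seq ((runs_forVars (inp := inp) (out := []) (a := s.arg)
      (fun _ => s.out.reverse) (fun i => List.replicate i true ++ false :: enc s.cur) (fun _ => [])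
      (fun _ _ _ => runs_push_cur _) s.n).seq runs_push_vars)
    have hn := h.n_le
    convert! hrun.mono (show _ ≤ symTime L by unfold symTime; lia) using 1
    simp [stk, step, bits]
  | vc => exact h.runs_flow_vc inp
  | hc => exact h.runs_flow_hc inp
  | fc =>
    convert! (runs_push_rev _).mono hpos using 1
    simp only [stk, step, List.reverse_append, List.reverse_singleton, List.singleton_append]
  | vo | ho | fo => exact (runs_skip _).mono (Nat.zero_le _)

theorem Inv.step_vc (h : s.Inv L (r + 1)) : (s.step .vc).Inv L r := by
  have hcur := h.cur_le
  obtain ⟨ha, hlen, hn, hlt, hout⟩ := h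
  have hnum : (s.cur[s.arg]?.elim [] PolySym.num).length ≤ L + 1 := by
    cases hc : s.cur[s.arg]? with
    | none => exact Nat.zero_le _
    | some c => simpa [PolySym.length_num] using hcur c (List.mem_of_getElem? hc)
  refine ⟨?_, ?_, ?_, hlt, ?_⟩ <;> simp only [Asm.step, List.length_append] <;> lia

theorem Inv.step_hc (h : s.Inv L (r + 1)) : (s.step .hc).Inv L r := by
  have hcur := h.cur_le
  obtain ⟨ha, hlen, hn, hlt, hout⟩ := h
  cases hc : s.cur[s.arg]? with
  | none =>
    simp only [Asm.step, hc]
    exact ⟨by lia, by lia, by lia, hlt, by lia⟩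
  | some c =>
    have hcL := hcur c (List.mem_of_getElem? hc)
    simp only [Asm.step, hc]
    refine ⟨by lia, by rw [List.length_set]; lia, by lia, fun c' hc' => ?_, ?_⟩
    · rcases List.mem_or_eq_of_mem_set hc' with hmem | rfl
      · exact (hlt c' hmem).trans (Nat.lt_succ_self _)
      · exact Nat.lt_succ_self _
    · simp only [List.length_append, PolySym.length_num, List.length_singleton]
      lia

theorem Inv.step (h : s.Inv L (r + 1)) (x : Sym) : (s.step x).Inv L r := by
  cases x with
  | vc => exact h.step_vc
  | hc => exact h.step_hc
  | wire =>
    obtain ⟨ha, hlen, hn, hlt, hout⟩ := h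
    refine ⟨?_, ?_, ?_, List.forall_mem_cons.2 ⟨Nat.lt_succ_self _, fun c hc =>
      (hlt c hc).trans (Nat.lt_succ_self _)⟩, ?_⟩ <;>
      simp only [Asm.step, List.length_cons] <;> lia
  | tick | fc | vo | ho | fo =>
    obtain ⟨ha, hlen, hn, hlt, hout⟩ := h
    refine ⟨?_, ?_, ?_, hlt, ?_⟩ <;>
      simp only [Asm.step, List.length_append, List.length_singleton] <;> lia

theorem Inv.foldl {w : List Sym} (h : s.Inv L w.length) : (w.foldl Asm.step s).Inv L 0 := by
  induction w generalizing s with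
  | nil => exact h
  | cons x w ih => exact ih (h.step x)

end Step

theorem inv_init (L : ℕ) : (⟨0, 0, [], []⟩ : Asm).Inv L L :=
  ⟨by simp, by simp, by simp, by simp, by simp⟩

/-- Write the string for the polynomial on `out`, and empty the other stacks. -/
def finish : FlowChart AsmΓ :=
  (loop .arg (fun _ => true) fun _ => skip).seq
    ((loop .cur (fun _ => true) fun _ => skip).seq
      ((loop .rev (fun _ => true) fun x : PolySym => push .out x).seq
        ((push .out PolySym.comma).seq
          (loop .vars (fun _ => true) fun _ => push .out PolySym.tick))))

theorem runs_loop_rev (n : ℕ) (rev : List PolySym) :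
    (loop .rev (fun _ => true) fun x : PolySym => push .out x : FlowChart AsmΓ).Runs
      (asmStk [] [] rev 0 0 n [] []) (asmStk [] rev.reverse [] 0 0 n [] [])
      (rev.length * 2 + 1) := by
  have h := runs_loop_reverse (k := AsmStack.rev) (cont := fun _ => true)
    (body := fun x : PolySym => push .out x) (fun out rev => asmStk [] out rev 0 0 n [] [])
    (fun _ _ => rfl) (fun _ _ _ => update_rev) (fun _ => rfl) (fun _ _ _ => runs_push_out _) [] rev
  rwa [List.append_nil] at h

theorem runs_loop_vars {out : List PolySym} (n : ℕ) :
    (loop .vars (fun _ => true) fun _ => push .out PolySym.tick : FlowChart AsmΓ).Runs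
      (asmStk [] out [] 0 0 n [] []) (asmStk [] (List.replicate n .tick ++ out) [] 0 0 0 [] [])
      (n * 2 + 1) := by
  refine runs_loop_replicate (k := AsmStack.vars) (cont := fun _ => true) (x := ())
    (fun i r => asmStk [] (List.replicate i .tick ++ out) [] 0 0 r [] []) rfl (t := 1)
    (fun i r => ⟨List.replicate r (), rfl, ?_⟩) n rfl
  rw [update_vars]
  exact runs_push_out _

/-- A bound for the time of `finish`. -/
def finishTime (L : ℕ) : ℕ :=
  L + 1 + (L * (L + 1) + 1 + (L * (2 * L + 3) * 2 + 1 + (1 + (L * 2 + 1))))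

theorem Inv.runs_finish {L : ℕ} {s : Asm} (h : s.Inv L 0) :
    finish.Runs (s.stk []) (asmStk [] (PolySym.num s.n ++ s.out) [] 0 0 0 [] [])
      (finishTime L) := by
  have henc : (enc s.cur).length ≤ L * (L + 1) :=
    (length_enc_le h.cur_le).trans (Nat.mul_le_mul_right _ h.length_cur_le)
  have harg : (loop .arg (fun _ => true) fun _ => skip : FlowChart AsmΓ).Runs (s.stk [])
      (asmStk [] [] s.out.reverse 0 0 s.n (enc s.cur) []) (L + 1) :=
    runs_loop_skip (update_arg (x := 0)) (List.length_replicate.le.trans h.arg_le)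
  have hcur : (loop .cur (fun _ => true) fun _ => skip : FlowChart AsmΓ).Runs
      (asmStk [] [] s.out.reverse 0 0 s.n (enc s.cur) [])
      (asmStk [] [] s.out.reverse 0 0 s.n [] []) (L * (L + 1) + 1) :=
    runs_loop_skip update_cur henc
  have hrun := harg.seq (hcur.seq ((runs_loop_rev s.n s.out.reverse).seq
    ((runs_push_out .comma).seq (runs_loop_vars s.n))))
  have hn := h.n_le
  have hout := h.length_out_le
  rw [Nat.zero_mul] at hout
  convert! hrun.mono (show _ ≤ finishTime L by
    rw [List.length_reverse]; unfold finishTime; lia) using 1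
  simp [PolySym.num]

/-- The assembler. -/
def program : FlowChart AsmΓ := (loop .inp (fun _ => true) flow).seq finish

theorem runs_program (w : List Sym) :
    program.Runs (asmStk w [] [] 0 0 0 [] []) (asmStk [] (assemble w) [] 0 0 0 [] [])
      (w.length * (symTime w.length + 1) + 1 + finishTime w.length) := by
  have hinit := inv_init w.length
  refine Runs.seq (S' := (w.foldl Asm.step ⟨0, 0, [], []⟩).stk []) ?_ hinit.foldl.runs_finish
  exact runs_loop_foldl (k := AsmStack.inp) (body := flow) (fun (s : Asm) (l : List Sym) => s.stk l)
    Asm.step (fun s l => Inv w.length l.length s) (fun _ _ => rfl) (fun _ _ _ => update_inp)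
    (fun s x l h => ⟨rfl, h.step x, h.runs_flow l x⟩) w ⟨0, 0, [], []⟩ hinit

end Asm

open Polynomial in
theorem polyTime_assemble : PolyTime id id assemble := by
  refine Asm.program.polyTime (k₀ := AsmStack.inp) (k₁ := AsmStack.out)
    (ea := fun w : List Sym => w) (eb := fun w : List PolySym => w)
    (X * (8 * X + 9 + (4 * X + 4) * (X + 2) + 1) + 1 +
      (X + 1 + (X * (X + 1) + 1 + (X * (2 * X + 3) * 2 + 1 + (1 + (X * 2 + 1)))))) fun w => ?_
  convert! Asm.runs_program w using 1
  · funext k; cases k <;> rfl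
  · funext k; cases k <;> rfl
  · simp only [eval_add, eval_mul, eval_X, eval_ofNat, eval_one]
    rfl

/-! ### From quantum circuits to strings of gates -/

/-- An argument of a diagonal gate. -/
def Sym.var (i : ℕ) : List Sym := .vo :: (List.replicate i .tick ++ [.vc])

/-- The string for a Hadamard gate. -/
def Sym.had (i : ℕ) : List Sym := .ho :: (List.replicate i .tick ++ [.hc])

/-- The string for a gate, where qubit `i` is wire `ν i`. -/
def Gate.encode {l : ℕ} (ν : Fin l → ℕ) : Gate l → List Sym
  | H i => Sym.had (ν i)
  | Z i => .fo :: (Sym.var (ν i) ++ [.fc])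
  | CZ i j _ => .fo :: (Sym.var (ν i) ++ (Sym.var (ν j) ++ [.fc]))
  | CCZ i j k _ _ _ => .fo :: (Sym.var (ν i) ++ (Sym.var (ν j) ++ (Sym.var (ν k) ++ [.fc])))

/-- A gate as a sequence of real gates, up to a factor; the additional qubit `0` is 0 for the real
part of a state and 1 for its imaginary part. -/
def QGate.realize {l : ℕ} : QGate l → List (Gate (l + 1))
  | hadamard a => [.H a.succ]
  | phase a => [.CZ a.succ 0 (Fin.succ_ne_zero a), .H 0, .CZ a.succ 0 (Fin.succ_ne_zero a), .H 0]
  | toffoli a b c hab hac hbc =>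
    [.H c.succ, .CCZ a.succ b.succ c.succ ((Fin.succ_injective l).ne hab)
      ((Fin.succ_injective l).ne hac) ((Fin.succ_injective l).ne hbc), .H c.succ]

/-- The exchange of opening and closing symbols. -/
def Sym.swap : Sym → Sym
  | .vo => .vc
  | .vc => .vo
  | .ho => .hc
  | .hc => .ho
  | .fo => .fc
  | .fc => .fo
  | s => s

/-- The string for the gates of a circuit in reverse order. -/
def Sym.mirror (w : List Sym) : List Sym := (w.map Sym.swap).reverse

theorem Sym.mirror_append (w w' : List Sym) : mirror (w ++ w') = mirror w' ++ mirror w := by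
  simp only [mirror, List.map_append, List.reverse_append]

/-- A column of Hadamard gates, followed by the real gates for a circuit. -/
def QCircuit.half (C : QCircuit) : List (Gate (C.qubits + 1)) :=
  (List.finRange (C.qubits + 1)).map .H ++ C.gates.flatMap QGate.realize

/-- The string for the circuit that conjugates a Z gate on the first qubit by a quantum circuit. -/
def QCircuit.transpile (C : QCircuit) : List Sym :=
  let w := C.half.flatMap (Gate.encode Fin.val)
  List.replicate (C.qubits + 1) .wire ++
    (w ++ ((Gate.Z (Fin.succ ⟨0, C.qubits_pos⟩)).encode Fin.val ++ Sym.mirror w))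

/-- The symbol at the start of the description of a gate. -/
def QGate.head {l : ℕ} : QGate l → CircSym
  | hadamard _ => .hadamard
  | phase _ => .phase
  | toffoli .. => .toffoli

/-- The qubits in the description of a gate. -/
def QGate.args {l : ℕ} : QGate l → List CircSym
  | hadamard a => CircSym.num a
  | phase a => CircSym.num a
  | toffoli a b c _ _ _ => CircSym.num a ++ CircSym.num b ++ CircSym.num c

theorem QGate.encode_eq {l : ℕ} (g : QGate l) : g.encode = g.head :: g.args := by
  cases g <;> rfl

/-- The stacks of the machine that transforms circuits. -/
inductive TranspilerStack : Type
  | inp | out | rev | tmp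
  | reg (i : Fin 3)
  deriving DecidableEq, Fintype

/-- The alphabets of the stacks. -/
def TrΓ : TranspilerStack → Type
  | .inp => CircSym
  | .out | .rev => Sym
  | .tmp | .reg _ => Unit

instance : Fintype CircSym where
  elems := ⟨↑[CircSym.tick, .comma, .hadamard, .phase, .toffoli], by simp⟩
  complete := by rintro ⟨⟩ <;> simp

instance (k : TranspilerStack) : Fintype (TrΓ k) := by
  cases k <;> unfold TrΓ <;> infer_instance

/-- Stack contents of the machine that transforms circuits. -/
def trStk (inp : List CircSym) (out rev : List Sym) (t : ℕ) (r : Fin 3 → ℕ) : Stk TrΓ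
  | .inp => inp
  | .out => out
  | .rev => rev
  | .tmp => List.replicate t ()
  | .reg i => List.replicate (r i) ()

namespace Transpiler

open FlowChart

section Stacks

variable {inp : List CircSym} {out rev : List Sym} {t : ℕ} {r : Fin 3 → ℕ}

theorem update_inp {x : List CircSym} : update (trStk inp out rev t r) .inp x =
    trStk x out rev t r := by
  funext k; cases k <;> rfl

theorem update_out {x : List Sym} : update (trStk inp out rev t r) .out x =
    trStk inp x rev t r := by
  funext k; cases k <;> rfl

theorem update_rev {x : List Sym} : update (trStk inp out rev t r) .rev x =
    trStk inp out x t r := by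
  funext k; cases k <;> rfl

theorem update_tmp {x : ℕ} : update (trStk inp out rev t r) .tmp (List.replicate x ()) =
    trStk inp out rev x r := by
  funext k; cases k <;> rfl

theorem update_reg {i : Fin 3} {x : ℕ} :
    update (trStk inp out rev t r) (.reg i) (List.replicate x ()) =
      trStk inp out rev t (update r i x) := by
  funext k
  cases k with
  | reg j =>
    by_cases h : j = i
    · subst h
      simp only [trStk, update_self]
    · rw [update_of_ne (by simpa using h)]
      simp only [trStk, update_of_ne h]
  | _ => rfl

theorem runs_push_out (x : Sym) : (push .out x : FlowChart TrΓ).Runs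
    (trStk inp out rev t r) (trStk inp (x :: out) rev t r) 1 :=
  runs_push update_out

theorem runs_push_rev (x : Sym) : (push .rev x : FlowChart TrΓ).Runs
    (trStk inp out rev t r) (trStk inp out (x :: rev) t r) 1 :=
  runs_push update_rev

theorem runs_push_tmp : (push .tmp () : FlowChart TrΓ).Runs
    (trStk inp out rev t r) (trStk inp out rev (t + 1) r) 1 :=
  runs_push (update_tmp (x := t + 1))

theorem runs_push_reg (i : Fin 3) (n : ℕ) : (push (.reg i) () : FlowChart TrΓ).Runs
    (trStk inp out rev t (update r i n)) (trStk inp out rev t (update r i (n + 1))) 1 := by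
  refine runs_push ?_
  have h := update_reg (inp := inp) (out := out) (rev := rev) (t := t) (r := update r i n) (i := i)
    (x := n + 1)
  rw [update_idem] at h
  simp only [trStk, update_self]
  exact h

/-- Run `F` once for each tick in a register. -/
def forReg (i : Fin 3) (F : FlowChart TrΓ) : FlowChart TrΓ :=
  (loop (.reg i) (fun _ => true) fun _ => (push .tmp ()).seq F).seq
    (loop .tmp (fun _ => true) fun _ => push (.reg i) ())

theorem runs_forReg {i : Fin 3} {F : FlowChart TrΓ} (out rev : ℕ → List Sym) {u : ℕ}
    (h : ∀ j t r, F.Runs (trStk inp (out j) (rev j) t r)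
      (trStk inp (out (j + 1)) (rev (j + 1)) t r) u) :
    (forReg i F).Runs (trStk inp (out 0) (rev 0) 0 r) (trStk inp (out (r i)) (rev (r i)) 0 r)
      (r i * (u + 4) + 2) := by
  have hloop := (runs_loop_replicate (k := TranspilerStack.reg i) (x := ()) (cont := fun _ => true)
    (body := fun _ => (push .tmp ()).seq F)
    (fun j n => trStk inp (out j) (rev j) j (update r i n)) rfl (t := 1 + u)
    (fun j n => ⟨List.replicate n (), by simp only [trStk, update_self]; rfl, ?_⟩) (r i)
    (by simp [trStk])).seq
    (runs_loop_replicate (k := TranspilerStack.tmp) (x := ()) (cont := fun _ => true)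
    (body := fun _ => (push (.reg i) () : FlowChart TrΓ))
    (fun j n => trStk inp (out (r i)) (rev (r i)) n (update r i j)) rfl (t := 1)
    (fun j n => ⟨List.replicate n (), rfl, ?_⟩) (r i) rfl)
  · rw [update_eq_self] at hloop
    exact hloop.mono (by ring_nf; lia)
  · rw [update_reg, update_idem]
    exact runs_push_tmp.seq (h j _ _)
  · rw [update_tmp]
    exact runs_push_reg i j

/-- Read a number into a register. -/
def readNum (i : Fin 3) : FlowChart TrΓ :=
  loop .inp (fun | CircSym.tick => true | _ => false) fun
    | CircSym.tick => push (.reg i) ()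
    | _ => skip

theorem runs_readNum (i : Fin 3) (m : ℕ) (hr : r i = 0) :
    (readNum i).Runs (trStk (CircSym.num m ++ inp) out rev t r)
      (trStk inp out rev t (update r i m)) (2 * m + 1) := by
  have h := runs_loop_iterate (k := TranspilerStack.inp)
    (cont := fun | CircSym.tick => true | _ => false)
    (body := fun | CircSym.tick => (push (.reg i) () : FlowChart TrΓ) | _ => skip)
    (x := CircSym.tick) (fun j n => trStk (CircSym.num n ++ inp) out rev t (update r i j))
    (t := 1) rfl
    (fun j n => ⟨CircSym.num n ++ inp, rfl, by rw [update_inp]; exact runs_push_reg i j⟩) 0 m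
    (runs_loop_exit (k := TranspilerStack.inp) (a := CircSym.comma) (l := inp) (t := 0) rfl rfl
      (by rw [update_inp, Nat.zero_add]; exact runs_skip _))
  rw [← hr, update_eq_self] at h
  exact h.mono (by lia)

/-- Empty the registers. -/
def clear : FlowChart TrΓ :=
  (loop (.reg 0) (fun _ => true) fun _ => skip).seq
    ((loop (.reg 1) (fun _ => true) fun _ => skip).seq
      (loop (.reg 2) (fun _ => true) fun _ => skip))

theorem runs_clear {b : ℕ} (hr : ∀ i, r i ≤ b) :
    clear.Runs (trStk inp out rev t r) (trStk inp out rev t 0) (3 * b + 3) := by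
  have hloop (i : Fin 3) (r : Fin 3 → ℕ) (hr : r i ≤ b) :
      (loop (.reg i) (fun _ => true) fun _ => skip : FlowChart TrΓ).Runs (trStk inp out rev t r)
        (trStk inp out rev t (update r i 0)) (b + 1) :=
    runs_loop_skip (update_reg (x := 0)) (List.length_replicate.le.trans hr)
  have h := (hloop 0 r (hr 0)).seq ((hloop 1 _ (by simpa using hr 1)).seq
    (hloop 2 _ (by simpa using hr 2)))
  have hzero : update (update (update r 0 0) 1 0) 2 0 = (0 : Fin 3 → ℕ) := by
    funext i
    fin_cases i <;> rfl
  rw [hzero] at h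
  exact h.mono (by lia)

theorem update_zero (i : Fin 3) : (update 0 i 0 : Fin 3 → ℕ) = 0 := update_eq_self i 0

end Stacks

section Write

/-- The stacks when the string `w` has been written. Its mirror image is written at the same time,
on another stack. -/
def stk (inp : List CircSym) (p w : List Sym) (t : ℕ) (r : Fin 3 → ℕ) : Stk TrΓ :=
  trStk inp (Sym.mirror w) (p ++ w).reverse t r

variable {inp : List CircSym} {p w : List Sym} {t b : ℕ} {r : Fin 3 → ℕ}

/-- Write a symbol and its mirror image. -/
def put (x : Sym) : FlowChart TrΓ := (push .rev x).seq (push .out x.swap)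

theorem runs_put (x : Sym) : (put x).Runs (stk inp p w t r) (stk inp p (w ++ [x]) t r) 2 := by
  convert! (runs_push_rev x).seq (runs_push_out x.swap) using 1
  simp [stk, Sym.mirror]

/-- The wire of a gate on four qubits: the additional one and those in the registers. -/
def wire (r : Fin 3 → ℕ) : Fin 4 → ℕ := Fin.cons 0 fun i => r i + 1

/-- Write the number of a wire. -/
def putWire : Fin 4 → FlowChart TrΓ :=
  Fin.cons skip fun i => (forReg i (put .tick)).seq (put .tick)

theorem runs_putWire (hr : ∀ i, r i ≤ b) (q : Fin 4) :
    (putWire q).Runs (stk inp p w 0 r) (stk inp p (w ++ List.replicate (wire r q) .tick) 0 r)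
      (6 * b + 4) := by
  cases q using Fin.cases with
  | zero =>
    rw [wire, Fin.cons_zero, List.replicate_zero, List.append_nil]
    exact (runs_skip _).mono (Nat.zero_le _)
  | succ i =>
    have hticks : (forReg i (put .tick)).Runs (stk inp p w 0 r)
        (stk inp p (w ++ List.replicate (r i) .tick) 0 r) (r i * (2 + 4) + 2) := by
      convert! runs_forReg (inp := inp) (r := r) (i := i) (F := put .tick)
        (fun j => Sym.mirror (w ++ List.replicate j .tick))
        (fun j => (p ++ (w ++ List.replicate j Sym.tick)).reverse) (fun j t r => ?_) using 1
      · rw [List.replicate_zero, List.append_nil]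
        rfl
      · rw [List.replicate_succ', ← List.append_assoc w]
        exact runs_put .tick
    have h := hticks.seq (runs_put .tick)
    rw [List.append_assoc, ← List.replicate_succ'] at h
    exact h.mono (by have := hr i; lia)

/-- Write an argument of a diagonal gate. -/
def putVar (q : Fin 4) : FlowChart TrΓ := (put .vo).seq ((putWire q).seq (put .vc))

theorem runs_putVar (hr : ∀ i, r i ≤ b) (q : Fin 4) :
    (putVar q).Runs (stk inp p w 0 r) (stk inp p (w ++ Sym.var (wire r q)) 0 r) (6 * b + 8) := by
  convert! ((runs_put .vo).seq ((runs_putWire hr q).seq (runs_put .vc))).mono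
    (show _ ≤ 6 * b + 8 by lia) using 1
  simp [Sym.var]

/-- Write a gate. -/
def putGate : Gate 4 → FlowChart TrΓ
  | .H i => (put .ho).seq ((putWire i).seq (put .hc))
  | .Z i => (put .fo).seq ((putVar i).seq (put .fc))
  | .CZ i j _ => (put .fo).seq ((putVar i).seq ((putVar j).seq (put .fc)))
  | .CCZ i j k _ _ _ =>
    (put .fo).seq ((putVar i).seq ((putVar j).seq ((putVar k).seq (put .fc))))

theorem runs_putGate (hr : ∀ i, r i ≤ b) (g : Gate 4) :
    (putGate g).Runs (stk inp p w 0 r) (stk inp p (w ++ g.encode (wire r)) 0 r)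
      (18 * b + 28) := by
  cases g with
  | H i =>
    convert! ((runs_put .ho).seq ((runs_putWire hr i).seq (runs_put .hc))).mono
      (show _ ≤ 18 * b + 28 by lia) using 1
    simp [Gate.encode, Sym.had]
  | Z i =>
    convert! ((runs_put .fo).seq ((runs_putVar hr i).seq (runs_put .fc))).mono
      (show _ ≤ 18 * b + 28 by lia) using 1
    simp [Gate.encode]
  | CZ i j _ =>
    convert! ((runs_put .fo).seq ((runs_putVar hr i).seq ((runs_putVar hr j).seq
      (runs_put .fc)))).mono (show _ ≤ 18 * b + 28 by lia) using 1
    simp [Gate.encode]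
  | CCZ i j k _ _ _ =>
    convert! ((runs_put .fo).seq ((runs_putVar hr i).seq ((runs_putVar hr j).seq
      ((runs_putVar hr k).seq (runs_put .fc))))).mono (show _ ≤ 18 * b + 28 by lia) using 1
    simp [Gate.encode]

/-- Write a list of gates. -/
def putGates (l : List (Gate 4)) : FlowChart TrΓ := seqs (l.map putGate)

theorem runs_putGates (hr : ∀ i, r i ≤ b) (l : List (Gate 4)) :
    (putGates l).Runs (stk inp p w 0 r) (stk inp p (w ++ l.flatMap (Gate.encode (wire r))) 0 r)
      (l.length * (18 * b + 28)) := by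
  induction l generalizing w with
  | nil =>
    rw [List.flatMap_nil, List.append_nil]
    exact (runs_skip _).mono (Nat.zero_le _)
  | cons g l ih =>
    rw [List.flatMap_cons, ← List.append_assoc, List.length_cons, Nat.succ_mul, add_comm]
    exact (runs_putGate hr g).seq ih

/-- Write a list of gates and empty the registers. -/
def flush (l : List (Gate 4)) : FlowChart TrΓ := (putGates l).seq clear

theorem runs_flush (hr : ∀ i, r i ≤ b) {l : List (Gate 4)} (hl : l.length ≤ 4) {w' : List Sym}
    (hw' : l.flatMap (Gate.encode (wire r)) = w') :
    (flush l).Runs (stk inp p w 0 r) (stk inp p (w ++ w') 0 0) (75 * b + 115) := by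
  subst hw'
  have := Nat.mul_le_mul_right (18 * b + 28) hl
  exact ((runs_putGates hr l).seq (runs_clear hr)).mono (by lia)

/-- Read and write a gate. -/
def gateFlow : CircSym → FlowChart TrΓ
  | .hadamard => (readNum 0).seq (flush (QGate.hadamard 0).realize)
  | .phase => (readNum 0).seq (flush (QGate.phase 0).realize)
  | .toffoli => (readNum 0).seq ((readNum 1).seq ((readNum 2).seq
      (flush (QGate.toffoli 0 1 2 (by decide) (by decide) (by decide)).realize)))
  | _ => skip

/-- A bound for the time to process a gate. -/
def gateTime (b : ℕ) : ℕ := 81 * b + 118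

theorem runs_gateFlow {m : ℕ} (hm : m ≤ b) (g : QGate m) :
    (gateFlow g.head).Runs (stk (g.args ++ inp) p w 0 0)
      (stk inp p (w ++ g.realize.flatMap (Gate.encode Fin.val)) 0 0) (gateTime b) := by
  have hone (a : Fin m) (i : Fin 3) : (update 0 0 (a : ℕ) : Fin 3 → ℕ) i ≤ b := by
    fin_cases i <;> simp
    lia
  cases g with
  | hadamard a =>
    have hflush := runs_flush (inp := inp) (p := p) (w := w) (hone a) (by decide)
      (l := (QGate.hadamard 0).realize) rfl
    exact ((runs_readNum 0 a rfl).seq hflush).mono (by unfold gateTime; lia)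
  | phase a =>
    have hflush := runs_flush (inp := inp) (p := p) (w := w) (hone a) (by decide)
      (l := (QGate.phase 0).realize) rfl
    exact ((runs_readNum 0 a rfl).seq hflush).mono (by unfold gateTime; lia)
  | toffoli a a' c hab hac hbc =>
    have hr (i : Fin 3) :
        (update (update (update 0 0 (a : ℕ)) 1 (a' : ℕ)) 2 (c : ℕ) : Fin 3 → ℕ) i ≤ b := by
      fin_cases i <;> simp <;> lia
    have hflush := runs_flush (inp := inp) (p := p) (w := w) hr (by decide)
      (l := (QGate.toffoli 0 1 2 (by decide) (by decide) (by decide)).realize)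
      (w' := (QGate.toffoli a a' c hab hac hbc).realize.flatMap (Gate.encode Fin.val))
      rfl
    rw [QGate.args, List.append_assoc, List.append_assoc]
    exact ((runs_readNum 0 a rfl).seq ((runs_readNum 1 a' rfl).seq
      ((runs_readNum 2 c rfl).seq hflush))).mono (by unfold gateTime; lia)

theorem runs_loop_gateFlow {m : ℕ} (hm : m ≤ b) (l : List (QGate m)) :
    (loop .inp (fun _ => true) gateFlow).Runs (stk (l.flatMap QGate.encode) p w 0 0)
      (stk [] p (w ++ (l.flatMap QGate.realize).flatMap (Gate.encode Fin.val)) 0 0)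
      ((l.flatMap QGate.encode).length * (gateTime b + 1) + 1) := by
  induction l generalizing w with
  | nil =>
    rw [List.flatMap_nil, List.flatMap_nil, List.flatMap_nil, List.append_nil]
    exact (runs_loop_nil rfl).mono (Nat.le_add_left ..)
  | cons g l ih =>
    rw [List.flatMap_cons, List.flatMap_cons, List.flatMap_append, ← List.append_assoc,
      QGate.encode_eq]
    refine (runs_loop_cons (k := TranspilerStack.inp) (a := g.head) rfl rfl (t := gateTime b)
      (l := g.args ++ l.flatMap QGate.encode) ?_ ih).mono ?_
    · rw [stk, update_inp]
      exact runs_gateFlow hm g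
    · simp only [List.length_append, List.length_cons, Nat.add_mul]
      lia

/-- Write a Hadamard gate on each wire but the first. -/
def layer : FlowChart TrΓ :=
  loop (.reg 0) (fun _ => true) fun _ => (putGate (.H 2)).seq (push (.reg 1) ())

theorem runs_layer {i n : ℕ} (hn : i + n ≤ b) :
    layer.Runs (stk inp p w 0 (update (update 0 0 n) 1 i))
      (stk inp p (w ++ (List.range' i n).flatMap fun j => Sym.had (j + 1)) 0
        (update 0 1 (i + n))) (n * (18 * b + 30) + 1) := by
  induction n generalizing i w with
  | zero =>
    rw [List.range'_zero, List.flatMap_nil, List.append_nil, Nat.add_zero, update_zero]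
    exact (runs_loop_nil rfl).mono (by lia)
  | succ n ih =>
    rw [List.range'_succ, List.flatMap_cons, ← List.append_assoc, Nat.add_comm n 1, ← Nat.add_assoc]
    have hr (k : Fin 3) : (update (update 0 0 n) 1 i : Fin 3 → ℕ) k ≤ b := by
      fin_cases k <;> simp <;> lia
    refine (runs_loop_cons (k := TranspilerStack.reg 0) (a := ()) (l := List.replicate n ()) ?_ rfl
      (t := 18 * b + 29) ?_ (ih (i := i + 1) (by lia))).mono (by lia)
    · rw [Nat.add_comm 1 n]
      rfl
    · rw [stk, update_reg, update_comm (by decide), update_idem]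
      exact (runs_putGate hr (.H 2)).seq (runs_push_reg 1 i)

/-- Write a column of Hadamard gates and empty the registers. -/
def column : FlowChart TrΓ := (putGate (.H 0)).seq (layer.seq clear)

theorem flatMap_encode_column (n : ℕ) :
    ((List.finRange (n + 1)).map Gate.H).flatMap (Gate.encode Fin.val) =
      Sym.had 0 ++ (List.range' 0 n).flatMap fun j => Sym.had (j + 1) := by
  rw [← List.range_eq_range', ← List.map_coe_finRange_eq_range, List.finRange_succ, List.map_cons,
    List.flatMap_cons, List.flatMap_map, List.flatMap_map, List.flatMap_map]
  rfl

theorem runs_column (n : ℕ) :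
    column.Runs (stk inp p w 0 (update 0 0 n))
      (stk inp p (w ++ ((List.finRange (n + 1)).map Gate.H).flatMap (Gate.encode Fin.val)) 0 0)
      (18 * n + 28 + (n * (18 * n + 30) + 1 + (3 * n + 3))) := by
  have hr (i j : Fin 3) : (update 0 i n : Fin 3 → ℕ) j ≤ n := by
    by_cases h : j = i <;> simp [h]
  have hlayer := runs_layer (inp := inp) (p := p)
    (w := w ++ (Gate.H 0).encode (wire (update 0 0 n))) (Nat.zero_add n).le
  rw [update_comm (by decide), update_zero, Nat.zero_add] at hlayer
  rw [flatMap_encode_column, ← List.append_assoc]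
  exact (runs_putGate (hr 0) (.H 0)).seq (hlayer.seq (runs_clear (hr 1)))

end Write

/-- Write the first half of the circuit, and its mirror image. -/
def writeHalf : FlowChart TrΓ :=
  (readNum 0).seq ((forReg 0 (push .rev Sym.wire)).seq ((push .rev Sym.wire).seq
    (column.seq (loop .inp (fun _ => true) gateFlow))))

/-- A bound for the time of `writeHalf`. -/
def halfTime (L : ℕ) : ℕ :=
  2 * L + 1 + (L * 5 + 2 + (1 + (18 * L + 28 + (L * (18 * L + 30) + 1 + (3 * L + 3)) +
    (L * (gateTime L + 1) + 1))))

theorem runs_writeHalf (C : QCircuit) : writeHalf.Runs (trStk C.encode [] [] 0 0)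
    (stk [] (List.replicate (C.qubits + 1) .wire) (C.half.flatMap (Gate.encode Fin.val)) 0 0)
    (halfTime C.encode.length) := by
  set q := C.qubits
  set inp := C.gates.flatMap QGate.encode
  have hlength : C.encode.length = q + 1 + inp.length := by
    rw [QCircuit.encode, List.length_append, CircSym.num, List.length_append, List.length_replicate,
      List.length_singleton]
  have hread := runs_readNum (inp := inp) (out := []) (rev := []) (t := 0) (r := 0) 0 q rfl
  have hwires := runs_forReg (inp := inp) (r := update 0 0 q) (i := 0) (fun _ => [])
    (fun j => List.replicate j Sym.wire) fun _ _ _ => runs_push_rev .wire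
  have hstk : trStk inp [] (.wire :: List.replicate q .wire) 0 (update 0 0 q) =
      stk inp (List.replicate (q + 1) .wire) [] 0 (update 0 0 q) := by
    rw [stk, List.append_nil, List.reverse_replicate, List.replicate_succ]
    rfl
  have hwire := runs_push_rev (inp := inp) (out := []) (rev := List.replicate q .wire) (t := 0)
    (r := update 0 0 q) .wire
  have hgates := runs_loop_gateFlow (p := List.replicate (q + 1) .wire)
    (w := ((List.finRange (q + 1)).map Gate.H).flatMap (Gate.encode Fin.val)) le_rfl C.gates
  rw [update_self] at hwires
  rw [hstk] at hwire
  rw [← List.flatMap_append] at hgates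
  refine (hread.seq (hwires.seq (hwire.seq ((runs_column q).seq hgates)))).mono ?_
  have hqL : q ≤ C.encode.length := by lia
  have hinpL : inp.length ≤ C.encode.length := by lia
  unfold halfTime gateTime
  gcongr

/-- The machine that transforms circuits. -/
def program : FlowChart TrΓ :=
  writeHalf.seq ((pushes .out ((Gate.Z (1 : Fin 2)).encode Fin.val).reverse).seq
    (loop .rev (fun _ => true) fun x : Sym => push .out x))

theorem runs_pushes_out {rev out : List Sym} (l : List Sym) : (pushes .out l : FlowChart TrΓ).Runs
    (trStk [] out rev 0 0) (trStk [] (l.reverse ++ out) rev 0 0) l.length :=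
  runs_pushes l update_out

theorem runs_loop_rev (out rev : List Sym) :
    (loop .rev (fun _ => true) fun x : Sym => push .out x : FlowChart TrΓ).Runs
      (trStk [] out rev 0 0) (trStk [] (rev.reverse ++ out) [] 0 0) (rev.length * 2 + 1) :=
  runs_loop_reverse (k := TranspilerStack.rev) (cont := fun _ => true)
    (body := fun x : Sym => push .out x) (fun out rev => trStk [] out rev 0 0) (fun _ _ => rfl)
    (fun _ _ _ => update_rev) (fun _ => rfl) (fun _ _ _ => runs_push_out _) out rev

theorem runs_program (C : QCircuit) : program.Runs (trStk C.encode [] [] 0 0)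
    (trStk [] C.transpile [] 0 0)
    (halfTime C.encode.length + (5 + (halfTime C.encode.length * 2 + 1))) := by
  have hhalf := runs_writeHalf C
  set p : List Sym := List.replicate (C.qubits + 1) .wire
  set w := C.half.flatMap (Gate.encode Fin.val)
  set z := (Gate.Z (1 : Fin 2)).encode Fin.val
  have hz := runs_pushes_out (rev := (p ++ w).reverse) (out := Sym.mirror w) z.reverse
  have hrev := runs_loop_rev (z ++ Sym.mirror w) (p ++ w).reverse
  rw [List.reverse_reverse] at hz
  rw [List.reverse_reverse, List.append_assoc] at hrev
  have hlength : (p ++ w).reverse.length ≤ 0 + halfTime C.encode.length :=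
    hhalf.length_le .rev
  have hzlength : z.reverse.length = 5 := rfl
  exact (hhalf.seq (hz.seq hrev)).mono (by lia)

end Transpiler

open Polynomial in
theorem polyTime_transpile : PolyTime QCircuit.encode id QCircuit.transpile := by
  let half : ℕ[X] := 2 * X + 1 + (X * 5 + 2 + (1 + (18 * X + 28 +
    (X * (18 * X + 30) + 1 + (3 * X + 3)) + (X * (81 * X + 118 + 1) + 1))))
  refine Transpiler.program.polyTime (k₀ := TranspilerStack.inp) (k₁ := TranspilerStack.out)
    (ea := QCircuit.encode) (eb := fun w : List Sym => w) (half + (5 + (half * 2 + 1))) fun C => ?_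
  convert! Transpiler.runs_program C using 1
  · funext k; cases k <;> rfl
  · funext k; cases k <;> rfl
  · simp only [half, eval_add, eval_mul, eval_X, eval_ofNat, eval_one]
    rfl

/-! ### The sign of an answer -/

/-- The stacks of the machine that reads the sign of the answer. -/
inductive SignStack : Type
  | inp | out
  deriving DecidableEq

instance : Fintype SignStack where
  elems := {.inp, .out}
  complete := by rintro ⟨⟩ <;> decide

/-- The alphabets of the stacks of the machine that reads the sign of the answer. -/
def SgnΓ : SignStack → Type
  | .inp => Option Bool
  | .out => Bool

instance (k : SignStack) : Fintype (SgnΓ k) := by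
  cases k <;> unfold SgnΓ <;> infer_instance

/-- Stack contents of the machine that reads the sign of the answer. -/
def sgnStk (inp : List (Option Bool)) (out : List Bool) : Stk SgnΓ
  | .inp => inp
  | .out => out

namespace SignReader

open FlowChart

theorem update_inp {inp x : List (Option Bool)} {out : List Bool} :
    update (sgnStk inp out) .inp x = sgnStk x out := by
  funext k; cases k <;> rfl

/-- The machine that reads the sign of the answer. -/
def program : FlowChart SgnΓ :=
  (loop .inp (fun x : Option Bool => x.isSome) fun _ => skip).seq
    ((loop .inp (fun _ => false) fun x : Option Bool => push .out (x.getD false)).seq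
      (loop .inp (fun _ => true) fun _ => skip))

theorem runs_loop_isSome (l : List Bool) (inp : List (Option Bool)) :
    (loop .inp (fun x : Option Bool => x.isSome) fun _ => skip : FlowChart SgnΓ).Runs
      (sgnStk (l.map some ++ none :: inp) []) (sgnStk inp []) (l.length + 1) := by
  induction l with
  | nil =>
    refine runs_loop_exit (k := SignStack.inp) (a := (none : Option Bool)) (l := inp) rfl rfl ?_
    rw [update_inp]
    exact runs_skip _
  | cons x l ih =>
    refine (runs_loop_cons (k := SignStack.inp) (a := some x) (l := l.map some ++ none :: inp)
      rfl rfl (t := 0) ?_ ih).mono (by rw [List.length_cons]; lia)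
    rw [update_inp]
    exact runs_skip _

theorem runs_program (l : List Bool) (b : Bool) (inp : List (Option Bool)) :
    program.Runs (sgnStk (l.map some ++ none :: some b :: inp) []) (sgnStk [] [b])
      (l.length + 1 + (2 + (inp.length + 1))) := by
  refine (runs_loop_isSome l _).seq (Runs.seq (S' := sgnStk inp [b]) ?_ ?_)
  · refine runs_loop_exit (k := SignStack.inp) (a := some b) (l := inp) (t := 1) rfl rfl ?_
    rw [update_inp]
    exact runs_push (by funext k; cases k <;> rfl)
  · exact runs_loop_skip update_inp le_rfl

end SignReader

open Polynomial in
theorem polyTime_neg : PolyTime encodeAnswer Computability.encodeBool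
    (fun p : List Bool × ℚ => decide (p.2 < 0)) := by
  refine SignReader.program.polyTime (k₀ := SignStack.inp) (k₁ := SignStack.out)
    (ea := encodeAnswer) (eb := Computability.encodeBool) (X + 2) fun p => ?_
  set w := (Computability.encodeNat p.2.num.natAbs).map some ++
    none :: (Computability.encodeNat p.2.den).map some
  have hencode : encodeAnswer p = p.1.map some ++ none :: some (decide (p.2 < 0)) :: w := by
    simp [encodeAnswer, w]
  have heval : (X + 2 : ℕ[X]).eval (encodeAnswer p).length =
      p.1.length + 1 + (2 + (w.length + 1)) := by
    rw [hencode, eval_add, eval_X, eval_ofNat, List.length_append, List.length_map]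
    simp only [List.length_cons]
    lia
  convert! SignReader.runs_program p.1 (decide (p.2 < 0)) w using 1
  · rw [hencode]
    funext k; cases k <;> rfl
  · funext k; cases k <;> rfl

/-! ### The polynomial of a circuit -/

/-- The sign `(-1) ^ b`. -/
def sgn (b : Bool) : ℝ := if b then -1 else 1

@[simp] theorem sgn_false : sgn false = 1 := rfl

@[simp] theorem sgn_true : sgn true = -1 := rfl

/-- A labelling under construction: the number of variables that occur so far, and the variable of
the current segment of each wire. -/
structure Labels (l : ℕ) where
  n : ℕ
  cur : Fin l → ℕ

namespace Gate

variable {l : ℕ}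

/-- A gate as an operator on real states. Hadamard gates are not normalised, so that circuits have
integer matrices. -/
def op : Gate l → ((Fin l → Bool) → ℝ) → (Fin l → Bool) → ℝ
  | H i, ψ => fun y => ψ (update y i false) + sgn (y i) * ψ (update y i true)
  | Z i, ψ => fun y => sgn (y i) * ψ y
  | CZ i j _, ψ => fun y => sgn (y i && y j) * ψ y
  | CCZ i j k _ _ _, ψ => fun y => sgn (y i && (y j && y k)) * ψ y

/-- The labelling after a gate. -/
def next : Gate l → Labels l → Labels l
  | H i, s => ⟨s.n + 1, update s.cur i s.n⟩
  | _, s => s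

/-- The variables of the monomial of a gate. -/
def term : Gate l → Labels l → List ℕ
  | H i, s => [s.cur i, s.n]
  | Z i, s => [s.cur i]
  | CZ i j _, s => [s.cur i, s.cur j]
  | CCZ i j k _ _ _, s => [s.cur i, s.cur j, s.cur k]

/-- Whether the gate is a Hadamard gate. -/
def isH : Gate l → Bool
  | H _ => true
  | _ => false

end Gate

/-- A product of one, two or three distinct variables with numbers below `n`. -/
structure IsMonomial (n : ℕ) (t : List ℕ) : Prop where
  ne_nil : t ≠ []
  length_le : t.length ≤ 3
  nodup : t.Nodup
  lt : ∀ k ∈ t, k < n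

namespace Labels

variable {l : ℕ} {s : Labels l}

/-- Different wires have different variables, and these are among the variables used so far. -/
structure Valid (s : Labels l) : Prop where
  inj : Injective s.cur
  lt : ∀ i, s.cur i < s.n

theorem Valid.next (hs : s.Valid) (g : Gate l) : (g.next s).Valid := by
  cases g with
  | H i =>
    have fresh (a : Fin l) : s.cur a ≠ s.n := (hs.lt a).ne
    refine ⟨fun a b hab => ?_, fun a => ?_⟩
    · simp only [Gate.next, update_apply] at hab
      split_ifs at hab with ha hb hb
      · rw [ha, hb]
      · exact absurd hab.symm (fresh b)
      · exact absurd hab (fresh a)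
      · exact hs.inj hab
    · simp only [Gate.next, update_apply]
      have := hs.lt a
      split_ifs <;> lia
  | _ => exact hs

theorem Valid.isMonomial_term (hs : s.Valid) (g : Gate l) :
    IsMonomial (g.next s).n (g.term s) := by
  have lt := hs.lt
  have le i := (lt i).le
  have ne i := (lt i).ne
  have eq_iff {i j} : s.cur i = s.cur j ↔ i = j := hs.inj.eq_iff
  cases g <;> constructor <;> simp [Gate.term, Gate.next, *]

/-- The labels at the start of a circuit. The order is that in which the assembler, which puts the
variables of the wires on a stack, counts the wires. -/
def start (l : ℕ) : Labels l := ⟨l, fun i => (i.rev : ℕ)⟩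

theorem valid_start : (start l).Valid :=
  ⟨fun _ _ h => Fin.rev_injective (Fin.ext h), fun i => i.rev.2⟩

end Labels

namespace InternalCircuit

variable {l : ℕ}

/-- The monomials of the gates of a circuit. -/
def monomials : InternalCircuit l → Labels l → List (List ℕ)
  | [], _ => []
  | g :: C, s => g.term s :: monomials C (g.next s)

/-- The number of Hadamard gates. -/
def numH (C : InternalCircuit l) : ℕ := C.countP Gate.isH

/-- The product of the operators of the gates. The first gate of the list is the leftmost factor, so
it is the last one to be applied to the state. -/
def op (C : InternalCircuit l) (ψ : (Fin l → Bool) → ℝ) : (Fin l → Bool) → ℝ := C.foldr Gate.op ψ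

/-- The segments that start with the Hadamard gates of a circuit. -/
def newSegments : InternalCircuit l → (Fin l → ℕ) → List (Fin l × ℕ)
  | [], _ => []
  | Gate.H i :: C, t => (i, t i + 1) :: newSegments C (update t i (t i + 1))
  | _ :: C, t => newSegments C t

/-- The segments, ordered like the variables that label them. -/
def segmentList (C : InternalCircuit l) : List (Fin l × ℕ) :=
  List.ofFn (fun k : Fin l => (k.rev, 0)) ++ C.newSegments fun _ => 0

theorem numH_cons (g : Gate l) (C : InternalCircuit l) :
    numH (g :: C) = numH C + if g.isH then 1 else 0 :=
  List.countP_cons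

theorem next_n_add (g : Gate l) (s : Labels l) (C : InternalCircuit l) :
    (g.next s).n + numH C = s.n + numH (g :: C) := by
  rw [numH_cons]
  cases g <;> simp only [Gate.next, Gate.isH, if_true, Bool.false_eq_true, if_false] <;> lia

theorem isMonomial_of_mem_monomials (C : InternalCircuit l) {s : Labels l} (hs : s.Valid) :
    ∀ t ∈ C.monomials s, IsMonomial (s.n + numH C) t := by
  induction C generalizing s with
  | nil => simp [monomials]
  | cons g C ih =>
    rw [← next_n_add, monomials, List.forall_mem_cons]
    have head := hs.isMonomial_term g
    exact ⟨{ head with lt := fun k hk => Nat.lt_add_right _ (head.lt k hk) }, ih (hs.next g)⟩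

theorem length_newSegments (C : InternalCircuit l) (t : Fin l → ℕ) :
    (C.newSegments t).length = numH C := by
  induction C generalizing t with
  | nil => rfl
  | cons g C ih => cases g <;> simp [newSegments, numH_cons, Gate.isH, ih]

theorem mem_newSegments (C : InternalCircuit l) (t : Fin l → ℕ) (q : Fin l) (m : ℕ) :
    (q, m) ∈ C.newSegments t ↔ t q < m ∧ m ≤ t q + C.hadamards q := by
  induction C generalizing t with
  | nil => simp [newSegments, hadamards]
  | cons g C ih =>
    cases g with
    | H i =>
      by_cases h : i = q
      · subst h
        simp only [newSegments, List.mem_cons, Prod.mk.injEq, true_and, ih, update_self]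
        simp only [hadamards, List.countP_cons, Gate.IsHadamardOn, decide_true, if_true]
        lia
      · simp [newSegments, ih, hadamards, Gate.IsHadamardOn, h, Ne.symm h]
    | _ => simp [newSegments, ih, hadamards, Gate.IsHadamardOn]

theorem nodup_newSegments (C : InternalCircuit l) (t : Fin l → ℕ) : (C.newSegments t).Nodup := by
  induction C generalizing t with
  | nil => exact List.nodup_nil
  | cons g C ih =>
    cases g with
    | H i =>
      refine List.nodup_cons.2 ⟨fun h => ?_, ih _⟩
      rw [mem_newSegments, update_self] at h
      exact h.1.false
    | _ => exact ih t

theorem length_segmentList (C : InternalCircuit l) : C.segmentList.length = l + numH C := by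
  simp [segmentList, length_newSegments]

theorem nodup_segmentList (C : InternalCircuit l) : C.segmentList.Nodup := by
  refine (List.nodup_ofFn.2 fun i j h => Fin.rev_injective (congrArg Prod.fst h)).append
    (nodup_newSegments _ _) fun s hs hs' => ?_
  obtain ⟨i, rfl⟩ := List.mem_ofFn.1 hs
  exact ((mem_newSegments ..).1 hs').1.false

theorem mem_segmentList (C : InternalCircuit l) (s : Fin l × ℕ) :
    s ∈ C.segmentList ↔ s ∈ C.segments := by
  obtain ⟨q, m⟩ := s
  have mem_first : (q, m) ∈ List.ofFn (fun k : Fin l => (k.rev, 0)) ↔ m = 0 := by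
    rw [List.mem_ofFn]
    exact ⟨fun ⟨_, h⟩ => (congrArg Prod.snd h).symm, fun h => ⟨q.rev, by simp [h]⟩⟩
  have mem_segments : (q, m) ∈ C.segments ↔ m ≤ C.hadamards q := Iff.rfl
  rw [segmentList, List.mem_append, mem_first, mem_newSegments, mem_segments]
  lia

open MvPolynomial in
theorem sum_monomials (L : List (Fin l × ℕ)) (C : InternalCircuit l) (s : Labels l) (t : Fin l → ℕ)
    (hcur : ∀ i, L[s.cur i]? = some (i, t i)) (hnew : L.drop s.n = C.newSegments t) :
    ((C.monomials s).map fun m => (m.map fun k => L[k]?.elim 0 X).prod).sum =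
      C.segmentPolyFrom t := by
  induction C generalizing s t with
  | nil => rfl
  | cons g C ih =>
    rw [monomials, List.map_cons, List.sum_cons]
    replace ih := ih (g.next s)
    cases g with
    | H i =>
      have new : L[s.n]? = some (i, t i + 1) := by
        rw [← Nat.add_zero s.n, ← List.getElem?_drop, hnew]
        rfl
      rw [ih (update t i (t i + 1)), segmentPolyFrom]
      · simp [Gate.term, hcur, new]
      · intro j
        rcases eq_or_ne j i with rfl | h
        · simp [Gate.next, new]
        · simp [Gate.next, h, hcur]
      · rw [Gate.next, ← List.tail_drop, hnew]
        rfl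
    | CCZ i j k hij hik hjk =>
      rw [ih t hcur hnew, segmentPolyFrom]
      simp [Gate.term, hcur, mul_assoc]
    | _ =>
      rw [ih t hcur hnew, segmentPolyFrom]
      simp [Gate.term, hcur]

end InternalCircuit

namespace CubicPoly

/-- The polynomial with the given monomials, whose variables are numbers. -/
def ofLists (n : ℕ) (M : List (List ℕ)) (h : ∀ t ∈ M, IsMonomial n t) : CubicPoly where
  n := n
  terms := M.pmap (fun t ht => t.pmap Fin.mk ht) fun t ht => (h t ht).lt
  terms_ok := by
    intro t' ht'
    obtain ⟨t, ht, rfl⟩ := List.mem_pmap.1 ht'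
    exact ⟨by simpa using (h t ht).ne_nil, by simpa using (h t ht).length_le,
      (h t ht).nodup.pmap fun _ _ _ _ => congrArg Fin.val⟩

/-- The monomials, with numbers as variables. -/
def monomials (P : CubicPoly) : List (List ℕ) := P.terms.map (List.map Fin.val)

theorem monomials_ofLists {n : ℕ} {M : List (List ℕ)} (h : ∀ t ∈ M, IsMonomial n t) :
    (ofLists n M h).monomials = M := by
  simp [monomials, ofLists, List.map_pmap]

/-- The string for a monomial. -/
def monomialString (t : List ℕ) : List PolySym := t.flatMap PolySym.num ++ [.semicolon]

theorem encode_eq (P : CubicPoly) :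
    P.encode = PolySym.num P.n ++ P.monomials.flatMap monomialString := by
  simp [encode, monomials, monomialString, List.flatMap_map, List.flatMap_assoc]

open MvPolynomial in
theorem rename_poly (P : CubicPoly) {σ : Type*} (e : Fin P.n → σ) (v : ℕ → MvPolynomial σ (ZMod 2))
    (hv : ∀ k : Fin P.n, v k = X (e k)) :
    rename e P.poly = (P.monomials.map fun t => (t.map v).prod).sum := by
  simp [poly, monomials, map_list_sum, map_list_prod, comp_def, hv]

end CubicPoly

/-! ### Gaps as sums over assignments -/

/-- The assignment to all natural numbers that is 0 from `n` on. -/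
def zeroExtend {n : ℕ} (x : Fin n → Bool) : ℕ → Bool :=
  fun k => if h : k < n then x ⟨k, h⟩ else false

@[simp] theorem zeroExtend_val {n : ℕ} (x : Fin n → Bool) (k : Fin n) : zeroExtend x k = x k :=
  dif_pos k.2

theorem zeroExtend_snoc {n : ℕ} (x : Fin n → Bool) (b : Bool) :
    zeroExtend (Fin.snoc (α := fun _ => Bool) x b) = update (zeroExtend x) n b := by
  funext k
  rcases lt_trichotomy k n with hk | rfl | hk
  · simp [zeroExtend, Fin.snoc, hk, hk.ne, Nat.lt_succ_of_lt hk]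
  · simp [zeroExtend, Fin.snoc]
  · simp [zeroExtend, hk.ne', not_lt_of_gt hk, Nat.not_lt.2 hk]

/-- A bit as an element of the field with two elements. -/
def bit : Bool ≃ ZMod 2 := finTwoEquiv.symm

theorem prod_bit (x : ℕ → Bool) (t : List ℕ) :
    (t.map fun k => bit (x k)).prod = bit (t.all x) := by
  induction t with
  | nil => rfl
  | cons k t ih =>
    rw [List.map_cons, List.prod_cons, ih, List.all_cons]
    generalize x k = a, t.all x = b
    revert a b
    decide

theorem sign_bit_add (b : Bool) (z : ZMod 2) :
    (if bit b + z = 0 then (1 : ℝ) else -1) = sgn b * if z = 0 then 1 else -1 := by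
  have hz : z = 0 ∨ z = 1 := by revert z; decide
  have bit_false : bit false = 0 := rfl
  have bit_true : bit true = 1 := rfl
  have one_add_one : (1 : ZMod 2) + 1 = 0 := rfl
  rcases hz with rfl | rfl <;> cases b <;> simp [bit_false, bit_true, one_add_one]

theorem sign_sum_bit (x : ℕ → Bool) (T : List (List ℕ)) :
    (if (T.map fun t => (t.map fun k => bit (x k)).prod).sum = 0 then (1 : ℝ) else -1) =
      (T.map fun t => sgn (t.all x)).prod := by
  simp only [prod_bit]
  induction T with
  | nil => simp
  | cons t T ih =>
    rw [List.map_cons, List.sum_cons, sign_bit_add, ih, List.map_cons, List.prod_cons]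

open MvPolynomial in
theorem CubicPoly.gap_poly (P : CubicPoly) :
    (gap P.poly : ℝ) =
      ∑ x : Fin P.n → Bool, (P.monomials.map fun t => sgn (t.all (zeroExtend x))).prod := by
  have eval_poly (x : Fin P.n → Bool) : eval (bit ∘ x) P.poly =
      (P.monomials.map fun t => (t.map fun k => bit (zeroExtend x k)).prod).sum := by
    simp [poly, monomials, map_list_sum, map_list_prod, comp_def]
  rw [gap, ← (Equiv.piCongrRight fun _ => bit).sum_comp]
  push_cast
  refine Finset.sum_congr rfl fun x _ => ?_
  rw [← sign_sum_bit, ← eval_poly]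
  rfl

/-- The sum over the values of the `h` variables from `n` on. -/
def sumVars : ℕ → ℕ → ((ℕ → Bool) → ℝ) → (ℕ → Bool) → ℝ
  | _, 0, F, x => F x
  | n, h + 1, F, x => sumVars (n + 1) h F (update x n false) + sumVars (n + 1) h F (update x n true)

theorem sumVars_mul {c F : (ℕ → Bool) → ℝ} {n : ℕ} (h : ℕ)
    (hc : ∀ x m b, n ≤ m → c (update x m b) = c x) (x : ℕ → Bool) :
    sumVars n h (fun x => c x * F x) x = c x * sumVars n h F x := by
  induction h generalizing n x with
  | zero => rfl
  | succ h ih =>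
    have ih := ih fun x m b hm => hc x m b (Nat.le_of_succ_le hm)
    rw [sumVars, sumVars, ih, ih, hc _ _ _ le_rfl, hc _ _ _ le_rfl, mul_add]

theorem sum_zeroExtend (F : (ℕ → Bool) → ℝ) (n h : ℕ) :
    ∑ x : Fin (n + h) → Bool, F (zeroExtend x) =
      ∑ x : Fin n → Bool, sumVars n h F (zeroExtend x) := by
  induction h generalizing n with
  | zero => rfl
  | succ h ih =>
    rw [← Nat.succ_add_eq_add_succ, ih (n + 1), ← (Fin.snocEquiv fun _ => Bool).sum_comp,
      Fintype.sum_prod_type, Finset.sum_comm]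
    refine Finset.sum_congr rfl fun x _ => ?_
    rw [Fintype.sum_bool, add_comm]
    simp only [Fin.snocEquiv, Equiv.coe_fn_mk, zeroExtend_snoc, sumVars]

namespace InternalCircuit

variable {l : ℕ}

theorem sgn_term_update {s : Labels l} (hs : s.Valid) (g : Gate l) (x : ℕ → Bool) (m : ℕ) (b : Bool)
    (hm : (g.next s).n ≤ m) :
    sgn ((g.term s).all (update x m b)) = sgn ((g.term s).all x) := by
  have update_eq k (hk : k ∈ g.term s) : update x m b k = x k :=
    update_of_ne (((hs.isMonomial_term g).lt k hk).trans_le hm).ne _ _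
  refine congrArg sgn (Bool.eq_iff_iff.2 ?_)
  simp +contextual only [List.all_eq_true, update_eq]

theorem update_comp_cur {s : Labels l} (hs : s.Valid) (i : Fin l) (x : ℕ → Bool) (b : Bool) :
    (fun j => update x s.n b (update s.cur i s.n j)) = update (fun j => x (s.cur j)) i b := by
  funext j
  rcases eq_or_ne j i with rfl | h
  · simp
  · simp [h, (hs.lt j).ne]

/-- The variables that are introduced by Hadamard gates are the summation variables of the matrix
products. -/
theorem sumVars_monomials (C : InternalCircuit l) {s : Labels l} (hs : s.Valid) (x : ℕ → Bool) :
    sumVars s.n (numH C) (fun x => ((C.monomials s).map fun t => sgn (t.all x)).prod) x =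
      op C (fun _ => 1) fun i => x (s.cur i) := by
  induction C generalizing s x with
  | nil => rfl
  | cons g C ih =>
    have tail (x) : sumVars (g.next s).n (numH C)
        (fun x => ((monomials (g :: C) s).map fun t => sgn (t.all x)).prod) x =
          sgn ((g.term s).all x) * op C (fun _ => 1) fun i => x ((g.next s).cur i) := by
      rw [← ih (hs.next g),
        ← sumVars_mul (c := fun x => sgn ((g.term s).all x)) _ (sgn_term_update hs g)]
      rfl
    change _ = g.op (op C fun _ => 1) _
    rw [numH_cons]
    cases g with
    | H i =>
      refine (congrArg₂ _ (tail _) (tail _)).trans ?_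
      simp [Gate.next, update_comp_cur hs, Gate.term, Gate.op, (hs.lt i).ne]
    | _ => exact (tail x).trans (by simp [Gate.term, Gate.op, Gate.next])

/-! ### The polynomial that corresponds to a circuit -/

/-- The polynomial of a circuit, as an input of an algorithm. -/
def cubicPoly (C : InternalCircuit l) : CubicPoly :=
  .ofLists (l + C.numH) (C.monomials (.start l)) (C.isMonomial_of_mem_monomials Labels.valid_start)

theorem monomials_cubicPoly (C : InternalCircuit l) :
    C.cubicPoly.monomials = C.monomials (.start l) :=
  CubicPoly.monomials_ofLists _

theorem encode_cubicPoly (C : InternalCircuit l) : C.cubicPoly.encode =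
    PolySym.num (l + C.numH) ++ (C.monomials (.start l)).flatMap CubicPoly.monomialString := by
  rw [CubicPoly.encode_eq, monomials_cubicPoly]
  rfl

theorem corresponds_cubicPoly (C : InternalCircuit l) (hC : ∀ q, ∃ g ∈ C, g.ActsOn q) :
    C.Corresponds C.cubicPoly.poly := by
  let e : Fin C.cubicPoly.n → Fin l × ℕ := C.segmentList.get ∘ Fin.cast C.length_segmentList.symm
  refine ⟨hC, e, ?_, ?_, ?_⟩
  · exact (List.nodup_iff_injective_get.1 C.nodup_segmentList).comp (Fin.cast_injective _)
  · refine ((finCongr C.length_segmentList.symm).surjective.range_comp _).trans ?_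
    rw [Set.range_list_get]
    exact Set.ext C.mem_segmentList
  · rw [CubicPoly.rename_poly _ e fun k => C.segmentList[k]?.elim 0 MvPolynomial.X,
      monomials_cubicPoly, segmentPoly]
    · refine sum_monomials _ _ _ _ (fun i => ?_) ?_
      · rw [segmentList, Labels.start,
          List.getElem?_append_left (i.rev.2.trans_eq List.length_ofFn.symm), List.getElem?_ofFn,
          dif_pos i.rev.2, Fin.eta, Fin.rev_rev]
      · simp [segmentList, Labels.start]
    · intro k
      rw [List.getElem?_eq_getElem (k.2.trans_eq C.length_segmentList.symm)]
      rfl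

theorem gap_cubicPoly (C : InternalCircuit l) :
    (gap C.cubicPoly.poly : ℝ) = ∑ y, C.op (fun _ => 1) y := by
  let F (x : ℕ → Bool) : ℝ := ((C.monomials (.start l)).map fun t => sgn (t.all x)).prod
  calc (gap C.cubicPoly.poly : ℝ)
      = ∑ x : Fin (l + C.numH) → Bool, F (zeroExtend x) := by
        rw [CubicPoly.gap_poly, monomials_cubicPoly]
        rfl
    _ = ∑ x : Fin l → Bool, C.op (fun _ => 1) fun i => x i.rev := by
        rw [sum_zeroExtend]
        refine Finset.sum_congr rfl fun x _ => ?_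
        simp_rw [← zeroExtend_val x]
        exact sumVars_monomials C Labels.valid_start _
    _ = ∑ y, C.op (fun _ => 1) y :=
        (Fin.revPerm.arrowCongr (Equiv.refl Bool)).sum_comp (C.op fun _ => 1)

end InternalCircuit

/-! ### The string of a circuit -/

namespace Gate

variable {l : ℕ}

/-- The same gate with its qubits listed in reverse order, as in mirrored strings. -/
def flip : Gate l → Gate l
  | H i => H i
  | Z i => Z i
  | CZ i j hij => CZ j i hij.symm
  | CCZ i j k hij hik hjk => CCZ k j i hjk.symm hik.symm hij.symm

theorem mirror_encode (g : Gate l) : Sym.mirror (g.encode Fin.val) = g.flip.encode Fin.val := by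
  cases g <;> simp [Sym.mirror, encode, flip, Sym.had, Sym.var, Sym.swap]

theorem mirror_flatMap_encode (C : InternalCircuit l) :
    Sym.mirror (C.flatMap (encode Fin.val)) = (C.reverse.map flip).flatMap (encode Fin.val) := by
  induction C with
  | nil => rfl
  | cons g C ih => simp [Sym.mirror_append, mirror_encode, ih]

end Gate

namespace InternalCircuit

open CubicPoly

variable {l : ℕ}

/-- The labelling after a circuit. -/
def run (C : InternalCircuit l) (s : Labels l) : Labels l := C.foldl (fun s g => g.next s) s

theorem run_n (C : InternalCircuit l) (s : Labels l) : (run C s).n = s.n + numH C := by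
  induction C generalizing s with
  | nil => rfl
  | cons g C ih => exact (ih _).trans (next_n_add g s C)

theorem monomials_append (C D : InternalCircuit l) (s : Labels l) :
    monomials (C ++ D) s = monomials C s ++ monomials D (run C s) := by
  induction C generalizing s with
  | nil => rfl
  | cons g C ih => exact congrArg _ (ih _)

/-- The assembler turns the string into the monomials of the circuit. -/
def Describes (w : List Sym) (C : InternalCircuit l) : Prop :=
  ∀ s out, w.foldl Asm.step ⟨0, s.n, List.ofFn s.cur, out⟩ =
    ⟨0, (C.run s).n, List.ofFn (C.run s).cur, out ++ (C.monomials s).flatMap monomialString⟩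

theorem Describes.append {w w' : List Sym} {C D : InternalCircuit l} (h : Describes w C)
    (h' : Describes w' D) : Describes (w ++ w') (C ++ D) := by
  intro s out
  rw [List.foldl_append, h, h', monomials_append, run, run, run, List.foldl_append,
    List.flatMap_append, List.append_assoc]

theorem foldl_step_ticks (a i n : ℕ) (cur : List ℕ) (out : List PolySym) :
    (List.replicate i Sym.tick).foldl Asm.step ⟨a, n, cur, out⟩ = ⟨a + i, n, cur, out⟩ := by
  induction i generalizing a with
  | zero => rfl
  | succ i ih => exact (ih (a + 1)).trans (by rw [Nat.succ_add_eq_add_succ])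

theorem foldl_step_var (i : Fin l) (n : ℕ) (cur : Fin l → ℕ) (out : List PolySym) :
    (Sym.var i).foldl Asm.step ⟨0, n, List.ofFn cur, out⟩ =
      ⟨0, n, List.ofFn cur, out ++ PolySym.num (cur i)⟩ := by
  simp [Sym.var, Asm.step, foldl_step_ticks]

theorem ofFn_update (f : Fin l → ℕ) (i : Fin l) (a : ℕ) :
    List.ofFn (update f i a) = (List.ofFn f).set i a := by
  refine List.ext_getElem (by simp) fun k _ _ => ?_
  simp [List.getElem_set, update_apply, Fin.ext_iff, eq_comm]

theorem foldl_step_had (i : Fin l) (n : ℕ) (cur : Fin l → ℕ) (out : List PolySym) :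
    (Sym.had i).foldl Asm.step ⟨0, n, List.ofFn cur, out⟩ =
      ⟨0, n + 1, List.ofFn (update cur i n), out ++ monomialString [cur i, n]⟩ := by
  simp [Sym.had, Asm.step, foldl_step_ticks, ofFn_update, monomialString]

theorem describes_gate (g : Gate l) : Describes (g.encode Fin.val) [g] := by
  intro s out
  cases g with
  | H i =>
    exact (foldl_step_had i s.n s.cur out).trans
      (by simp [run, Gate.next, monomials, Gate.term])
  | _ =>
    simp [Gate.encode, Asm.step, foldl_step_var, run, Gate.next, monomials, Gate.term,
      monomialString]

theorem describes_gates (C : InternalCircuit l) :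
    Describes (C.flatMap (Gate.encode Fin.val)) C := by
  induction C with
  | nil => intro s out; simp [run, monomials]
  | cons g C ih => exact (describes_gate g).append ih

theorem foldl_step_wires (l : ℕ) : (List.replicate l Sym.wire).foldl Asm.step ⟨0, 0, [], []⟩ =
    ⟨0, l, List.ofFn (Labels.start l).cur, []⟩ := by
  induction l with
  | zero => rfl
  | succ l ih =>
    rw [List.replicate_succ', List.foldl_append, ih]
    simp [Asm.step, List.ofFn_succ, Labels.start]

theorem assemble_eq_encode {w : List Sym} {C : InternalCircuit l} (h : Describes w C) :
    assemble (List.replicate l Sym.wire ++ w) = C.cubicPoly.encode := by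
  rw [assemble, List.foldl_append, foldl_step_wires, encode_cubicPoly]
  refine (congrArg (fun s : Asm => PolySym.num s.n ++ s.out) (h (.start l) [])).trans ?_
  rw [run_n]
  rfl

end InternalCircuit

namespace QCircuit

/-- The circuit `U† Z U`, where `U` is a column of Hadamard gates followed by a real form of the
quantum circuit, and `Z` acts on the first qubit. -/
def sandwich (C : QCircuit) : InternalCircuit (C.qubits + 1) :=
  C.half ++ .Z (Fin.succ ⟨0, C.qubits_pos⟩) :: C.half.reverse.map Gate.flip

theorem assemble_transpile (C : QCircuit) : assemble C.transpile = C.sandwich.cubicPoly.encode := by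
  refine InternalCircuit.assemble_eq_encode ?_
  rw [Gate.mirror_flatMap_encode]
  exact (InternalCircuit.describes_gates _).append
    ((InternalCircuit.describes_gate _).append (InternalCircuit.describes_gates _))

theorem exists_actsOn_sandwich (C : QCircuit) (q : Fin (C.qubits + 1)) :
    ∃ g ∈ C.sandwich, g.ActsOn q :=
  ⟨.H q, by simp [sandwich, half], rfl⟩

end QCircuit

/-! ### Operators of circuits -/

theorem sgn_sq (b : Bool) : sgn b ^ 2 = 1 := by cases b <;> simp

theorem two_mul_sum_update {m : ℕ} (i : Fin m) (F : (Fin m → Bool) → ℝ) :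
    2 * ∑ y, F y = ∑ y, (F (update y i false) + F (update y i true)) := by
  have involutive_not : Involutive fun y : Fin m → Bool => update y i (!y i) := fun y => by simp
  have sum_not : ∑ y, F (update y i (!y i)) = ∑ y, F y :=
    Equiv.sum_comp (involutive_not.toPerm _) F
  rw [two_mul]
  nth_rw 2 [← sum_not]
  rw [← Finset.sum_add_distrib]
  refine Finset.sum_congr rfl fun y _ => ?_
  cases hy : y i
  · rw [← hy, update_eq_self, hy, Bool.not_false]
  · rw [← hy, update_eq_self, hy, Bool.not_true, add_comm]

namespace Gate

variable {m : ℕ}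

theorem sum_mul_op (g : Gate m) (φ ψ : (Fin m → Bool) → ℝ) :
    ∑ y, φ y * g.op ψ y = ∑ y, g.op φ y * ψ y := by
  cases g with
  | H i =>
    refine mul_left_cancel₀ (two_ne_zero (α := ℝ)) ?_
    rw [two_mul_sum_update i, two_mul_sum_update i]
    refine Finset.sum_congr rfl fun y _ => ?_
    simp only [op, update_self, update_idem, sgn_false, sgn_true]
    ring
  | _ => exact Finset.sum_congr rfl fun y _ => by simp only [op]; ring

theorem sum_op_sq (g : Gate m) (ψ : (Fin m → Bool) → ℝ) :
    ∑ y, g.op ψ y ^ 2 = (if g.isH then 2 else 1) * ∑ y, ψ y ^ 2 := by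
  cases g with
  | H i =>
    refine mul_left_cancel₀ (two_ne_zero (α := ℝ)) ?_
    rw [isH, if_pos rfl, two_mul_sum_update i, two_mul_sum_update i, Finset.mul_sum]
    refine Finset.sum_congr rfl fun y _ => ?_
    simp only [op, update_self, update_idem, sgn_false, sgn_true]
    ring
  | _ => simp [op, isH, mul_pow, sgn_sq]

theorem op_flip (g : Gate m) : g.flip.op = g.op := by
  cases g with
  | CZ i j => funext ψ y; simp only [flip, op, Bool.and_comm]
  | CCZ i j k => funext ψ y; simp only [flip, op, Bool.and_comm, Bool.and_left_comm]
  | _ => rfl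

theorem op_smul (g : Gate m) (c : ℝ) (ψ : (Fin m → Bool) → ℝ) : g.op (c • ψ) = c • g.op ψ := by
  cases g <;> funext y <;> simp only [op, Pi.smul_apply, smul_eq_mul] <;> ring

end Gate

namespace InternalCircuit

variable {m : ℕ}

/-- The action of a circuit on a state: the gates are applied in their order. -/
def evolve (C : InternalCircuit m) (ψ : (Fin m → Bool) → ℝ) : (Fin m → Bool) → ℝ :=
  C.foldl (fun ψ g => g.op ψ) ψ

theorem op_reverse (C : InternalCircuit m) (ψ : (Fin m → Bool) → ℝ) :
    op C.reverse ψ = evolve C ψ :=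
  List.foldr_reverse ..

theorem op_append (C D : InternalCircuit m) (ψ : (Fin m → Bool) → ℝ) :
    op (C ++ D) ψ = op C (op D ψ) :=
  List.foldr_append ..

theorem evolve_append (C D : InternalCircuit m) (ψ : (Fin m → Bool) → ℝ) :
    evolve (C ++ D) ψ = evolve D (evolve C ψ) :=
  List.foldl_append ..

theorem op_map_flip (C : InternalCircuit m) (ψ : (Fin m → Bool) → ℝ) :
    op (C.map Gate.flip) ψ = op C ψ := by
  rw [op, List.foldr_map]
  simp only [Gate.op_flip]
  rfl

theorem sum_mul_op (C : InternalCircuit m) (φ ψ : (Fin m → Bool) → ℝ) :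
    ∑ y, φ y * op C ψ y = ∑ y, evolve C φ y * ψ y := by
  induction C generalizing φ with
  | nil => rfl
  | cons g C ih => exact (g.sum_mul_op φ _).trans (ih _)

theorem sum_evolve_sq (C : InternalCircuit m) (ψ : (Fin m → Bool) → ℝ) :
    ∑ y, evolve C ψ y ^ 2 = 2 ^ numH C * ∑ y, ψ y ^ 2 := by
  induction C generalizing ψ with
  | nil => simp [evolve, numH]
  | cons g C ih =>
    refine (ih _).trans ?_
    rw [g.sum_op_sq, numH_cons, pow_add, mul_assoc, pow_ite, pow_one, pow_zero]

theorem evolve_smul (C : InternalCircuit m) (c : ℝ) (ψ : (Fin m → Bool) → ℝ) :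
    evolve C (c • ψ) = c • evolve C ψ := by
  induction C generalizing ψ with
  | nil => rfl
  | cons g C ih => exact (congrArg (evolve C) (g.op_smul c ψ)).trans (ih _)

theorem numH_append (C D : InternalCircuit m) : numH (C ++ D) = numH C + numH D :=
  List.countP_append

theorem numH_map_flip (C : InternalCircuit m) : numH (C.map Gate.flip) = numH C := by
  have isH_flip (g : Gate m) : g.flip.isH = g.isH := by cases g <;> rfl
  simp [numH, List.countP_map, comp_def, isH_flip]

theorem numH_reverse (C : InternalCircuit m) : numH C.reverse = numH C :=
  List.countP_reverse

theorem numH_hadamards (L : List (Fin m)) : numH (L.map Gate.H) = L.length := by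
  simp [numH, List.countP_map, comp_def, Gate.isH]

theorem op_hadamards {L : List (Fin m)} (hL : L.Nodup) : op (L.map Gate.H) (fun _ => 1) =
    fun y => if ∀ i ∈ L, y i = false then 2 ^ L.length else 0 := by
  induction L with
  | nil => simp [op]
  | cons i L ih =>
    obtain ⟨hi, hL⟩ := List.nodup_cons.1 hL
    refine (congrArg (Gate.H i).op (ih hL)).trans ?_
    funext y
    have update_iff (b : Bool) :
        (∀ j ∈ L, update y i b j = false) ↔ ∀ j ∈ L, y j = false :=
      forall₂_congr fun j hj => by rw [update_of_ne (ne_of_mem_of_not_mem hj hi)]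
    simp only [Gate.op, update_iff, List.forall_mem_cons, List.length_cons]
    by_cases hy : ∀ j ∈ L, y j = false
    · cases y i <;> simp [if_pos hy, pow_succ', two_mul]
    · simp [hy]

theorem evolve_column :
    evolve ((List.finRange m).map Gate.H) (fun _ => 1) =
      (2 : ℝ) ^ m • Pi.single (fun _ => false) 1 := by
  rw [← op_reverse, ← List.map_reverse,
    op_hadamards (List.nodup_reverse.2 (List.nodup_finRange m))]
  funext y
  simp [Pi.single_apply, funext_iff]

end InternalCircuit

/-! ### Quantum circuits over real numbers -/

open InternalCircuit

/-- A complex state as a real state with an additional qubit `0`, which is 0 for the real part and 1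
for the imaginary part. -/
def realify {l : ℕ} (ψ : QState l) : (Fin (l + 1) → Bool) → ℝ :=
  fun y => if y 0 then (ψ (Fin.tail y)).im else (ψ (Fin.tail y)).re

section Realify

variable {l : ℕ}

theorem realify_update (ψ : QState l) (y : Fin (l + 1) → Bool) (a : Fin l) (b : Bool) :
    realify ψ (update y a.succ b) = realify (fun x => ψ (update x a b)) y := by
  simp [realify, Fin.tail_update_succ, update_of_ne (Fin.succ_ne_zero a).symm]

theorem realify_single :
    realify (Pi.single (fun _ => false) 1 : QState l) = Pi.single (fun _ => false) 1 := by
  funext y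
  have eq_iff : (y = fun _ => false) ↔ y 0 = false ∧ Fin.tail y = fun _ => false := by
    simp only [funext_iff, Fin.forall_fin_succ, Fin.tail]
  simp only [realify, Pi.single_apply, eq_iff]
  cases y 0 <;> by_cases h : Fin.tail y = fun _ => false <;> simp [h]

theorem sum_mul_realify_sq (ψ : QState l) (w : (Fin l → Bool) → ℝ) :
    ∑ y, w (Fin.tail y) * realify ψ y ^ 2 = ∑ x, w x * ‖ψ x‖ ^ 2 := by
  rw [← (Fin.consEquiv fun _ : Fin (l + 1) => Bool).sum_comp, Fintype.sum_prod_type,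
    Fintype.sum_bool, ← Finset.sum_add_distrib]
  refine Finset.sum_congr rfl fun x _ => ?_
  simp only [Fin.consEquiv, Equiv.coe_fn_mk, realify, Fin.tail_cons, Fin.cons_zero, if_true,
    Bool.false_eq_true, if_false, Complex.sq_norm, Complex.normSq_apply]
  ring

theorem evolve_realize_hadamard (a : Fin l) (ψ : QState l) :
    evolve (QGate.hadamard a).realize (realify ψ) = √2 • realify ((QGate.hadamard a).apply ψ) := by
  funext y
  have coe_inv : (1 : ℂ) / (√2 : ℝ) = ((1 / √2 : ℝ) : ℂ) := by push_cast; rfl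
  have mul_inv : √2 * (1 / √2) = 1 := mul_one_div_cancel (by positivity)
  have tail_apply : Fin.tail y a = y a.succ := rfl
  simp only [QGate.realize, evolve, List.foldl_cons, List.foldl_nil, Gate.op, realify_update,
    Pi.smul_apply, smul_eq_mul]
  simp only [realify, QGate.apply, coe_inv, tail_apply, Complex.re_ofReal_mul,
    Complex.im_ofReal_mul, ← mul_ite, ← mul_assoc, mul_inv]
  cases y 0 <;> cases y a.succ <;> simp

theorem evolve_realize_phase (a : Fin l) (ψ : QState l) :
    evolve (QGate.phase a).realize (realify ψ) = (2 : ℝ) • realify ((QGate.phase a).apply ψ) := by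
  funext y
  have tail_apply : Fin.tail y a = y a.succ := rfl
  simp only [QGate.realize, evolve, List.foldl_cons, List.foldl_nil, Gate.op, Pi.smul_apply,
    smul_eq_mul]
  simp only [realify, QGate.apply, tail_apply, Fin.tail_update_zero, ne_eq, Fin.succ_ne_zero,
    not_false_eq_true, update_of_ne, update_self, update_idem, Bool.and_false, Bool.and_true,
    sgn_false, sgn_true, Bool.false_eq_true, if_true, if_false]
  cases y 0 <;> cases y a.succ <;> simp <;> ring

theorem evolve_realize_toffoli (a b c : Fin l) (hab : a ≠ b) (hac : a ≠ c) (hbc : b ≠ c)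
    (ψ : QState l) :
    evolve (QGate.toffoli a b c hab hac hbc).realize (realify ψ) =
      (2 : ℝ) • realify ((QGate.toffoli a b c hab hac hbc).apply ψ) := by
  funext y
  have tail_apply (q : Fin l) : Fin.tail y q = y q.succ := rfl
  simp only [QGate.realize, evolve, List.foldl_cons, List.foldl_nil, Gate.op, realify_update,
    Pi.smul_apply, smul_eq_mul]
  simp only [realify, QGate.apply, tail_apply, ne_eq, Fin.succ_inj, hac, hbc, not_false_eq_true,
    update_of_ne, update_self, update_idem, Bool.and_false, Bool.and_true, sgn_false, sgn_true]
  cases y 0 <;> cases y a.succ <;> cases y b.succ <;> cases y c.succ <;> simp <;> ring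

theorem evolve_realize (g : QGate l) (ψ : QState l) :
    evolve g.realize (realify ψ) = √2 ^ numH g.realize • realify (g.apply ψ) := by
  have sq_sqrt : √2 ^ 2 = 2 := Real.sq_sqrt zero_le_two
  cases g with
  | hadamard a => exact (evolve_realize_hadamard a ψ).trans (congrArg (· • _) (pow_one _).symm)
  | phase a => exact (evolve_realize_phase a ψ).trans (congrArg (· • _) sq_sqrt.symm)
  | toffoli a b c hab hac hbc =>
    exact (evolve_realize_toffoli a b c hab hac hbc ψ).trans (congrArg (· • _) sq_sqrt.symm)

theorem evolve_flatMap_realize (gs : List (QGate l)) (ψ : QState l) :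
    evolve (gs.flatMap QGate.realize) (realify ψ) =
      √2 ^ numH (gs.flatMap QGate.realize) • realify (gs.foldl (fun ψ g => g.apply ψ) ψ) := by
  induction gs generalizing ψ with
  | nil => simp [evolve, numH]
  | cons g gs ih =>
    rw [List.flatMap_cons, evolve_append, evolve_realize, evolve_smul, ih, smul_smul, numH_append,
      pow_add, List.foldl_cons]

end Realify

-- Equality in `hz` is impossible, as 3 does not divide `2 ^ k`: this excludes `a = 0`.
theorem neg_of_abs_sub_le {k : ℕ} {z : ℤ} {a : ℚ} (hz : (z : ℝ) ≤ 2 ^ k * (-1 / 3))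
    (ha : |(a : ℝ) - z| ≤ 1 / 3 * 2 ^ k) : a < 0 := by
  have z_ne : (3 : ℤ) * z ≠ -2 ^ k := fun h => by
    have three_dvd : (3 : ℤ) ∣ 2 ^ k := dvd_neg.1 ⟨z, h.symm⟩
    exact absurd (Int.prime_three.dvd_of_dvd_pow three_dvd) (by decide)
  have three_mul_le : (3 : ℤ) * z ≤ -2 ^ k := by
    exact_mod_cast (by linarith : (3 : ℝ) * z ≤ -2 ^ k)
  have three_mul_lt : (3 : ℝ) * z < -2 ^ k := by exact_mod_cast three_mul_le.lt_of_ne z_ne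
  exact_mod_cast (by linarith [(abs_le.1 ha).2] : (a : ℝ) < 0)

namespace QCircuit

variable (C : QCircuit)

theorem numH_half : numH C.half = C.qubits + 1 + numH (C.gates.flatMap QGate.realize) := by
  rw [half, numH_append, numH_hadamards, List.length_finRange]

theorem evolve_half : evolve C.half (fun _ => 1) =
    (2 ^ (C.qubits + 1) * √2 ^ numH (C.gates.flatMap QGate.realize)) • realify C.output := by
  rw [half, evolve_append, evolve_column, evolve_smul, ← realify_single, evolve_flatMap_realize,
    smul_smul]
  rfl

theorem sum_mul_evolve_half_sq (w : (Fin C.qubits → Bool) → ℝ) :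
    ∑ y, w (Fin.tail y) * evolve C.half (fun _ => 1) y ^ 2 =
      2 ^ (C.qubits + 1 + numH C.half) * ∑ x, w x * ‖C.output x‖ ^ 2 := by
  have factor_sq (m r : ℕ) : ((2 : ℝ) ^ m * √2 ^ r) ^ 2 = 2 ^ (m + (m + r)) := by
    rw [mul_pow, ← pow_mul √2, mul_comm r, pow_mul √2, Real.sq_sqrt zero_le_two]
    ring
  rw [numH_half, ← factor_sq, ← sum_mul_realify_sq, Finset.mul_sum, evolve_half]
  refine Finset.sum_congr rfl fun y _ => ?_
  rw [Pi.smul_apply, smul_eq_mul]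
  ring

theorem sum_norm_output_sq : ∑ x, ‖C.output x‖ ^ 2 = 1 := by
  have scaled := C.sum_mul_evolve_half_sq fun _ => 1
  simp only [one_mul] at scaled
  rw [sum_evolve_sq] at scaled
  refine mul_left_cancel₀ (pow_ne_zero (C.qubits + 1 + numH C.half) (two_ne_zero (α := ℝ))) ?_
  rw [← scaled]
  simp [pow_add, mul_comm]

theorem sum_sgn_mul_norm_output_sq :
    ∑ x, sgn (x ⟨0, C.qubits_pos⟩) * ‖C.output x‖ ^ 2 = 1 - 2 * C.acceptProb := by
  rw [← C.sum_norm_output_sq, acceptProb, Finset.mul_sum, ← Finset.sum_sub_distrib]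
  refine Finset.sum_congr rfl fun x _ => ?_
  cases x ⟨0, C.qubits_pos⟩
  · simp
  · rw [sgn_true, if_pos rfl]
    ring

theorem numH_sandwich : C.sandwich.numH = 2 * numH C.half := by
  rw [sandwich, numH_append, numH_cons, numH_map_flip, numH_reverse, two_mul]
  rfl

theorem gap_sandwich : (gap C.sandwich.cubicPoly.poly : ℝ) =
    2 ^ (C.qubits + 1 + numH C.half) * (1 - 2 * C.acceptProb) := by
  rw [gap_cubicPoly, sandwich, op_append, ← sum_sgn_mul_norm_output_sq, ← sum_mul_evolve_half_sq]
  have transpose := sum_mul_op C.half (fun _ => 1)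
    (op (.Z (Fin.succ ⟨0, C.qubits_pos⟩) :: C.half.reverse.map Gate.flip) fun _ => 1)
  simp only [one_mul] at transpose
  rw [transpose]
  refine Finset.sum_congr rfl fun y _ => ?_
  change _ * (sgn _ * op (C.half.reverse.map Gate.flip) _ y) = _
  rw [op_map_flip, op_reverse, Fin.tail]
  ring

theorem estimationError_sandwich_le :
    1 / 3 * (2 : ℝ) ^ (((C.sandwich.cubicPoly.n : ℝ) +
      (circuitWidth C.sandwich.cubicPoly.poly : ℝ)) / 2) ≤
      1 / 3 * 2 ^ (C.qubits + 1 + numH C.half) := by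
  have width_le : circuitWidth C.sandwich.cubicPoly.poly ≤ C.qubits + 1 :=
    Nat.sInf_le ⟨_, corresponds_cubicPoly _ C.exists_actsOn_sandwich⟩
  have n_eq : C.sandwich.cubicPoly.n = C.qubits + 1 + 2 * numH C.half :=
    congrArg (C.qubits + 1 + ·) C.numH_sandwich
  rw [← Real.rpow_natCast]
  gcongr
  · exact one_le_two
  · rw [div_le_iff₀ two_pos]
    exact_mod_cast (by lia : _ ≤ (C.qubits + 1 + numH C.half) * 2)

theorem neg_of_two_thirds_le_acceptProb {a : ℚ} (hC : 2 / 3 ≤ C.acceptProb)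
    (ha : |(a : ℝ) - gap C.sandwich.cubicPoly.poly| ≤
      1 / 3 * (2 : ℝ) ^ (((C.sandwich.cubicPoly.n : ℝ) +
        (circuitWidth C.sandwich.cubicPoly.poly : ℝ)) / 2)) : a < 0 := by
  refine neg_of_abs_sub_le ?_ (ha.trans C.estimationError_sandwich_le)
  rw [gap_sandwich]
  gcongr
  linarith

theorem nonneg_of_acceptProb_le_one_third {a : ℚ} (hC : C.acceptProb ≤ 1 / 3)
    (ha : |(a : ℝ) - gap C.sandwich.cubicPoly.poly| ≤
      1 / 3 * (2 : ℝ) ^ (((C.sandwich.cubicPoly.n : ℝ) +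
        (circuitWidth C.sandwich.cubicPoly.poly : ℝ)) / 2)) : 0 ≤ a := by
  replace ha := ha.trans C.estimationError_sandwich_le
  rw [gap_sandwich] at ha
  have scale_pos : (0 : ℝ) < 2 ^ (C.qubits + 1 + numH C.half) := by positivity
  exact_mod_cast (by nlinarith [(abs_le.1 ha).1] : (0 : ℝ) ≤ a)

end QCircuit

end CubicGap

theorem proposition4 :
    CubicGap.EstimationBQPHard CubicGap.CubicPoly.encode
      (fun P => (CubicGap.gap P.poly : ℝ))
      (fun P => 1 / 3 * (2 : ℝ) ^ (((P.n : ℝ) + (CubicGap.circuitWidth P.poly : ℝ)) / 2)) := by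
  rintro L ⟨C, hC, hL⟩
  refine ⟨fun x => (C x).sandwich.cubicPoly, fun p => decide (p.2 < 0), ?_, CubicGap.polyTime_neg,
    fun x a ha => ?_⟩
  · exact ((hC.comp CubicGap.polyTime_transpile).comp CubicGap.polyTime_assemble).congr fun x =>
      (C x).assemble_transpile
  · rw [decide_eq_true_iff]
    refine ⟨fun ha0 => by_contra fun hx => ?_, fun hx => ?_⟩
    · exact ((C x).nonneg_of_acceptProb_le_one_third ((hL x).2 hx) ha).not_gt ha0
    · exact (C x).neg_of_two_thirds_le_acceptProb ((hL x).1 hx) ha
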